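/- Let $0<q<1$, $d\ge 2$ and $\boldsymbol\alpha=(\alpha_1,\dots,\alpha_d)$ with all $\alpha_i>0$. For $\alpha>0$ let $V^{(\alpha)}$ be the complex inner product space with orthonormal (algebraic) basis $e_n^{(\alpha)}$, $n\ge 0$, and operators $$A_0e_n=\bigl(n+\tfrac{\alpha+1}{2}\bigr)e_n,\quad A_+e_n=\sqrt{\sigma_{n+1}}\,e_{n+1},\quad A_-e_n=\sqrt{\sigma_n}\,e_{n-1},\qquad \sigma_n=q^{1/2}\frac{(1-q^n)(1-q^{n+\alpha})}{(1-q)^2}.$$ Let $W=V^{(\alpha_1)}\otimes\cdots\otimes V^{(\alpha_d)}$ (algebraic tensor product) with orthonormal basis $e_{\mathbf y}=e_{y_1}^{(\alpha_1)}\otimes\cdots\otimes e_{y_d}^{(\alpha_d)}$, $\mathbf y\in\mathbb Z_{\ge0}^d$. Let $A_0^{(k)},A_\pm^{(k)}$ be $A_0,A_\pm$ acting on the $k$-th factor, and for $1\le i<j\le d$ put $$A_0^{[i;j]}=\sum_{k=i}^jA_0^{(k)},\qquad A_\pm^{[i;j]}=\sum_{k=i}^j q^{\sum_{\ell=i}^{k-1}A_0^{(\ell)}}A_\pm^{(k)},$$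 $$\Gamma^{[i;j]}=\frac{q^{-1/2}q^{A_0^{[i;j]}}+q^{1/2}q^{-A_0^{[i;j]}}}{(q^{1/2}-q^{-1/2})^2}-A_+^{[i;j]}A_-^{[i;j]}q^{1-A_0^{[i;j]}},\qquad \gamma(a)=\frac{q^{a/2}+q^{-a/2}}{(q^{1/2}-q^{-1/2})^2}.$$ With $(a;q)_n=\prod_{i=0}^{n-1}(1-aq^i)$ and integers $0\le x\le N$, $0\le n\le N$, let $\widehat h_n(x,\alpha,\beta,N;q)=\sqrt{\omega/\eta}\;h_n$, where $$h_n=(q^{\alpha+1};q)_n(q^{-N};q)_n\;{}_3\phi_2\!\left(\begin{matrix}q^{-n},\,q^{n+\alpha+\beta+1},\,q^{-x}\\ q^{\alpha+1},\,q^{-N}\end{matrix};q,q\right),\qquad \omega=\frac{(q^{\alpha+1};q)_x(q^{\beta+1};q)_{N-x}}{(q;q)_x(q;q)_{N-x}}q^{(N-x)(\alpha+1)},$$ $$\eta=\frac{(q^{\alpha+\beta+2};q)_{n+N}}{(q;q)_{N-n}}\,q^{2\binom n2-2Nn}\,\frac{1-q^{\alpha+\beta+1}}{1-q^{2n+\alpha+\beta+1}}\,\frac{(q;q)_n(q^{\alpha+1};q)_n(q^{\beta+1};q)_n}{(q^{\alpha+\beta+1};q)_n}\,q^{n(\alpha+1)},$$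 and let $\widehat h_n(x,\alpha,\beta,N;q)=0$ for all other integers $x,N$ and $n\ge0$. For $\mathbf m,\mathbf y\in\mathbb Z_{\ge0}^d$ write $M_k=\sum_{i=1}^km_i$, $Y_k=\sum_{i=1}^ky_i$, $A_k=\sum_{i=1}^k\alpha_i$, $\widetilde Y_k=\sum_{i=2}^ky_i$, $\widetilde A_k=\sum_{i=2}^k\alpha_i$, and define $$\Xi_{\mathbf m}(\mathbf y)=\delta_{M_dY_d}\prod_{k=1}^{d-2}\widehat h_{m_k}\bigl(\widetilde Y_{k+1}-M_{k-1},\,2M_{k-1}+\widetilde A_{k+1}+k-1,\,\alpha_{k+2},\,\widetilde Y_{k+2}-M_{k-1};q\bigr)$$ $$\times\;\widehat h_{m_{d-1}}\bigl(y_1,\,\alpha_1,\,2M_{d-2}+\widetilde A_d+d-2,\,Y_d-M_{d-2};q\bigr).$$ Then, all sums having only finitely many non-zero terms, $$\sum_{\mathbf y}\Xi_{\mathbf m}(\mathbf y)\,\Xi_{\mathbf m'}(\mathbf y)=\delta_{\mathbf m\mathbf m'},\qquad \sum_{\mathbf m}\Xi_{\mathbf m}(\mathbf y)\,\Xi_{\mathbf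 m}(\mathbf y')=\delta_{\mathbf y\mathbf y'}.$$ Moreover there is an orthonormal basis $(u_{\mathbf m})$ of $W$ satisfying the joint eigenvalue equations $$\Gamma^{[2;k]}u_{\mathbf m}=\gamma(2M_{k-2}+\widetilde A_k+k-2)\,u_{\mathbf m}\quad(3\le k\le d),$$ $$\Gamma^{[1;d]}u_{\mathbf m}=\gamma(2M_{d-1}+A_d+d-1)\,u_{\mathbf m},\qquad q^{A_0^{[1;d]}}u_{\mathbf m}=q^{M_d+(A_d+d)/2}\,u_{\mathbf m},$$ which these equations determine up to multiplying each $u_{\mathbf m}$ by a phase, and, with a suitable choice of the phases, $$u_{\mathbf m}=\sum_{\mathbf y}\Xi_{\mathbf m}(\mathbf y)\,e_{\mathbf y},\qquad e_{\mathbf y}=\sum_{\mathbf m}\Xi_{\mathbf m}(\mathbf y)\,u_{\mathbf m}.$$ -/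

import Mathlib

open scoped TensorProduct

noncomputable section

namespace SUq

/-! ### Indexing: multi-indices are functions on `Fin d`, written with labels `1, …, d` -/

/-- The entry `x_k` of `x = (x_1, …, x_d)`, for `1 ≤ k ≤ d` (and `0` for any other label). -/
def entry {R : Type*} [Zero R] {d : ℕ} (x : Fin d → R) (k : ℕ) : R :=
  if h : 1 ≤ k ∧ k ≤ d then x ⟨k - 1, by omega⟩ else 0

/-- The partial sum `x_i + x_{i+1} + ⋯ + x_j` (zero if `j < i`). -/
def psum {R : Type*} [AddCommMonoid R] {d : ℕ} (x : Fin d → R) (i j : ℕ) : R :=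
  ∑ k ∈ Finset.Icc i j, entry x k

/-- The set `[i;j] = {i, …, j}` of tensor factors; the factor with label `k` is `k - 1 : Fin d`. -/
def interval (d i j : ℕ) : Finset (Fin d) :=
  Finset.univ.filter fun k => i ≤ (k : ℕ) + 1 ∧ (k : ℕ) + 1 ≤ j

/-! ### The univariate `q`-Hahn functions -/

/-- The `q`-Pochhammer symbol `(a;q)_n`. -/
def qPoch (a q : ℝ) (n : ℕ) : ℝ := ∏ i ∈ Finset.range n, (1 - a * q ^ i)

/-- The basic hypergeometric series `₃φ₂(a₁, a₂, a₃; b₁, b₂; q, z)`. -/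
def phi32 (a₁ a₂ a₃ b₁ b₂ q z : ℝ) : ℝ :=
  ∑' k : ℕ, (qPoch a₁ q k * qPoch a₂ q k * qPoch a₃ q k) /
    (qPoch q q k * qPoch b₁ q k * qPoch b₂ q k) * z ^ k

/-- The `q`-Hahn polynomial `h_n(x, α, β, N; q)`, for `0 ≤ n ≤ N`. -/
def qHahn (q : ℝ) (n x : ℕ) (α β : ℝ) (N : ℕ) : ℝ :=
  qPoch (q ^ (α + 1)) q n * qPoch (q ^ (-(N : ℝ))) q n *
    phi32 (q ^ (-(n : ℝ))) (q ^ ((n : ℝ) + α + β + 1)) (q ^ (-(x : ℝ)))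
      (q ^ (α + 1)) (q ^ (-(N : ℝ))) q q

/-- The weight `ω(x; α, β, N; q)`, for `0 ≤ x ≤ N`. -/
def omega (q : ℝ) (x : ℕ) (α β : ℝ) (N : ℕ) : ℝ :=
  (qPoch (q ^ (α + 1)) q x * qPoch (q ^ (β + 1)) q (N - x)) / (qPoch q q x * qPoch q q (N - x)) *
    q ^ (((N : ℝ) - x) * (α + 1))

/-- The normalization `η(n, α, β, N; q)`, for `0 ≤ n ≤ N`. -/
def eta (q : ℝ) (n : ℕ) (α β : ℝ) (N : ℕ) : ℝ :=
  qPoch (q ^ (α + β + 2)) q (n + N) / qPoch q q (N - n) *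
    q ^ (2 * (n.choose 2 : ℝ) - 2 * (N : ℝ) * n) *
    ((1 - q ^ (α + β + 1)) / (1 - q ^ (2 * (n : ℝ) + α + β + 1))) *
    ((qPoch q q n * qPoch (q ^ (α + 1)) q n * qPoch (q ^ (β + 1)) q n) /
      qPoch (q ^ (α + β + 1)) q n) *
    q ^ ((n : ℝ) * (α + 1))

/-- The `q`-Hahn function `ĥ_n(x, α, β, N; q) = √(ω / η) h_n`. It lives on `0 ≤ x ≤ N` and
`0 ≤ n ≤ N`, and is zero elsewhere (as the Clebsch–Gordan coefficients are, and in accordance with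
`1 / (q;q)_{-k} = 0` for `k ≥ 1`). -/
def qHahnHat (q : ℝ) (n : ℕ) (x : ℤ) (α β : ℝ) (N : ℤ) : ℝ :=
  if 0 ≤ x ∧ x ≤ N ∧ (n : ℤ) ≤ N then
    Real.sqrt (omega q x.toNat α β N.toNat / eta q n α β N.toNat) *
      qHahn q n x.toNat α β N.toNat
  else 0

/-- The function `Ξ_m^{(α)}(y)`. -/
def Xi {d : ℕ} (q : ℝ) (α : Fin d → ℝ) (m y : Fin d → ℕ) : ℝ :=
  let M : ℕ → ℕ := psum m 1
  let Y : ℕ → ℕ := psum y 1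
  let Yt : ℕ → ℕ := psum y 2
  let At : ℕ → ℝ := psum α 2
  (if M d = Y d then 1 else 0) *
    (∏ k ∈ Finset.Icc 1 (d - 2),
      qHahnHat q (entry m k) ((Yt (k + 1) : ℤ) - M (k - 1))
        (2 * (M (k - 1) : ℝ) + At (k + 1) + k - 1) (entry α (k + 2))
        ((Yt (k + 2) : ℤ) - M (k - 1))) *
    qHahnHat q (entry m (d - 1)) ((entry y 1 : ℕ) : ℤ)
      (entry α 1) (2 * (M (d - 2) : ℝ) + At d + d - 2)
      ((Y d : ℤ) - M (d - 2))

/-! ### Positive-discrete series representations of `su_q(1,1)` -/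

/-- The underlying space of `V^{(α)}`: the complex vector space with basis `e_0, e_1, …`. -/
def V : Type := ℕ →₀ ℂ

instance : AddCommGroup V := inferInstanceAs (AddCommGroup (ℕ →₀ ℂ))

instance : Module ℂ V := inferInstanceAs (Module ℂ (ℕ →₀ ℂ))

/-- The basis `e_0, e_1, …` of `V^{(α)}`. -/
def eV : Module.Basis ℕ ℂ V := (Finsupp.basisSingleOne : Module.Basis ℕ ℂ (ℕ →₀ ℂ))

/-- The matrix elements `σ_n^{(α)}`. -/
def sigma (q α : ℝ) (n : ℕ) : ℝ :=
  q ^ (1 / 2 : ℝ) * ((1 - q ^ n) * (1 - q ^ ((n : ℝ) + α))) / (1 - q) ^ 2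

/-- The operator `q^{s A_0}` on `V^{(α)}`: since `A_0 e_n = (n + (α + 1) / 2) e_n`, it acts by
`e_n ↦ q^{s (n + (α + 1) / 2)} e_n`. -/
def qA0 (q s α : ℝ) : Module.End ℂ V :=
  eV.constr ℂ fun n : ℕ =>
    ((q ^ (s * ((n : ℝ) + (α + 1) / 2)) : ℝ) : ℂ) • eV n

/-- The operator `A_+` on `V^{(α)}`: `e_n ↦ √σ_{n+1} e_{n+1}`. -/
def Aplus (q α : ℝ) : Module.End ℂ V :=
  eV.constr ℂ fun n : ℕ =>
    ((Real.sqrt (sigma q α (n + 1)) : ℝ) : ℂ) • eV (n + 1)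

/-- The operator `A_-` on `V^{(α)}`: `e_n ↦ √σ_n e_{n-1}`, where `σ_0 = 0`. -/
def Aminus (q α : ℝ) : Module.End ℂ V :=
  eV.constr ℂ fun n : ℕ =>
    ((Real.sqrt (sigma q α n) : ℝ) : ℂ) • eV (n - 1)

/-- The underlying space of `W^{(α)} = V^{(α_1)} ⊗ ⋯ ⊗ V^{(α_d)}`. -/
abbrev W (d : ℕ) : Type := ⨂[ℂ] _ : Fin d, V

/-- The direct-product basis `e_y = e_{y_1} ⊗ ⋯ ⊗ e_{y_d}`, as a basis of `W`. -/
def e (d : ℕ) : Module.Basis (Fin d → ℕ) ℂ (W d) :=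
  Basis.piTensorProduct fun _ : Fin d => eV

theorem e_apply {d : ℕ} (y : Fin d → ℕ) :
    e d y = PiTensorProduct.tprod ℂ fun k => eV (y k) := by
  simp [e]

/-- The inner product on `W` (conjugate-linear in the first argument) with
`⟨e_y, e_{y'}⟩ = δ_{y y'}`. -/
def ip {d : ℕ} (v w : W d) : ℂ :=
  ((e d).repr v).sum fun y c => (starRingEnd ℂ) c * (e d).repr w y

/-- The operator `1 ⊗ ⋯ ⊗ A ⊗ ⋯ ⊗ 1` acting by `A` on the factor `k`. -/
def site {d : ℕ} (k : Fin d) (A : Module.End ℂ V) : Module.End ℂ (W d) :=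
  PiTensorProduct.map fun l => if l = k then A else LinearMap.id

/-- The operator `q^{s A_0^S}`, `A_0^S = ∑_{k ∈ S} A_0^{(k)}`: the tensor product of the operators
`q^{s A_0}` on the factors in `S` and of the identity on the others. -/
def qA0Set {d : ℕ} (q s : ℝ) (α : Fin d → ℝ) (S : Finset (Fin d)) : Module.End ℂ (W d) :=
  PiTensorProduct.map fun l => if l ∈ S then qA0 q s (α l) else LinearMap.id

/-- `A_+^{[i;j]} = ∑_{k=i}^{j} q^{A_0^{(i)} + ⋯ + A_0^{(k-1)}} A_+^{(k)}`. -/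
def AplusSet {d : ℕ} (q : ℝ) (α : Fin d → ℝ) (i j : ℕ) : Module.End ℂ (W d) :=
  ∑ k ∈ interval d i j, qA0Set q 1 α (interval d i k) * site k (Aplus q (α k))

/-- `A_-^{[i;j]} = ∑_{k=i}^{j} q^{A_0^{(i)} + ⋯ + A_0^{(k-1)}} A_-^{(k)}`. -/
def AminusSet {d : ℕ} (q : ℝ) (α : Fin d → ℝ) (i j : ℕ) : Module.End ℂ (W d) :=
  ∑ k ∈ interval d i j, qA0Set q 1 α (interval d i k) * site k (Aminus q (α k))

/-- The intermediate Casimir operator `Γ^{[i;j]}`, equal to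
`(q^{-1/2} q^{A_0} + q^{1/2} q^{-A_0}) / (q^{1/2} - q^{-1/2})^2 - A_+ A_- q^{1 - A_0}`
in the generators attached to `[i;j]`. -/
def Casimir {d : ℕ} (q : ℝ) (α : Fin d → ℝ) (i j : ℕ) : Module.End ℂ (W d) :=
  (((q ^ (1 / 2 : ℝ) - q ^ (-1 / 2 : ℝ)) ^ 2 : ℝ) : ℂ)⁻¹ •
      (((q ^ (-1 / 2 : ℝ) : ℝ) : ℂ) • qA0Set q 1 α (interval d i j) +
        ((q ^ (1 / 2 : ℝ) : ℝ) : ℂ) • qA0Set q (-1) α (interval d i j)) -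
    AplusSet q α i j * AminusSet q α i j * ((q : ℂ) • qA0Set q (-1) α (interval d i j))

/-- The Casimir eigenvalue `γ(a)` of `V^{(a)}`. -/
def gamma (q a : ℝ) : ℝ :=
  (q ^ (a / 2) + q ^ (-a / 2)) / (q ^ (1 / 2 : ℝ) - q ^ (-1 / 2 : ℝ)) ^ 2

/-! ### The coupled basis -/

/-- The joint eigenvalue equations of `Γ^{[2;3]}, …, Γ^{[2;d]}, Γ^{[1;d]}, q^{A_0^{[1;d]}}` with
the eigenvalues labelled by the multi-index `m`. -/
structure JointEigen {d : ℕ} (q : ℝ) (α : Fin d → ℝ) (m : Fin d → ℕ) (w : W d) : Prop where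
  intermediate : ∀ k : ℕ, 3 ≤ k → k ≤ d →
    Casimir q α 2 k w =
      ((gamma q (2 * ((psum m 1 (k - 2) : ℕ) : ℝ) + psum α 2 k + k - 2) : ℝ) : ℂ) • w
  full : Casimir q α 1 d w =
      ((gamma q (2 * ((psum m 1 (d - 1) : ℕ) : ℝ) + psum α 1 d + d - 1) : ℝ) : ℂ) • w
  weight : qA0Set q 1 α (interval d 1 d) w =
      ((q ^ (((psum m 1 d : ℕ) : ℝ) + (psum α 1 d + d) / 2) : ℝ) : ℂ) • w

/-- `u` is an orthonormal basis of `W` whose members satisfy the joint eigenvalue equations. -/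
structure IsCoupledBasis {d : ℕ} (q : ℝ) (α : Fin d → ℝ) (u : (Fin d → ℕ) → W d) : Prop where
  orthonormal : ∀ m m' : Fin d → ℕ, ip (u m) (u m') = if m = m' then 1 else 0
  span : Submodule.span ℂ (Set.range u) = ⊤
  eigen : ∀ m : Fin d → ℕ, JointEigen q α m (u m)

end SUq

end

/-!
The `q`-Hahn functions are Clebsch–Gordan coefficients. Given a family of vectors indexed by
multi-indices on which one copy of `su_q(1,1)` raises and lowers the index at `p`, acting with type
`a`, and a second copy does so at `p'` with type `b`, summing the family against
`ĥ_n(·, a, b, N; q)` over `s_p + s_{p'} = N` gives a family on which the coproduct acts at `p'` with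
type `a + b + 1 + 2n`, the new label `n` being put at `p`. That the action is again by ladder
operators is a contiguous relation for the `q`-Hahn functions, and their orthonormality follows from
the mutual adjointness of the two operators, with the norm at `n = N` given by the
`q`-Vandermonde sum.

Coupling the factors `2, 3, …, d` one after the other and finally the factor `1`, the coefficients
multiply to `Ξ`, and a Casimir operator reads off the type of each intermediate representation. The
resulting families are orthonormal and homogeneous in the total degree, so on each degree `Ξ` is a
square matrix with orthonormal rows, hence orthogonal. The joint eigenvalues separate the
multi-indices, which gives uniqueness up to phases.
-/

noncomputable section

namespace SUq

open Finset.HasAntidiagonal (antidiagonal mem_antidiagonal)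
open Function (update)

/-! ### The `q`-Pochhammer symbol -/

section qPoch

variable {q : ℝ}

@[simp]
theorem qPoch_zero (a q : ℝ) : qPoch a q 0 = 1 := by simp [qPoch]

theorem qPoch_succ (a q : ℝ) (n : ℕ) : qPoch a q (n + 1) = qPoch a q n * (1 - a * q ^ n) :=
  Finset.prod_range_succ _ n

theorem qPoch_add (a q : ℝ) (m n : ℕ) :
    qPoch a q (m + n) = qPoch a q m * qPoch (a * q ^ m) q n := by
  simp only [qPoch, Finset.prod_range_add, pow_add, mul_assoc]

theorem qPoch_succ' (a q : ℝ) (n : ℕ) : qPoch a q (n + 1) = (1 - a) * qPoch (a * q) q n := by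
  rw [add_comm, qPoch_add]
  simp [qPoch]

theorem one_sub_mul_qPoch (a q : ℝ) (n : ℕ) :
    (1 - a) * qPoch (a * q) q n = qPoch a q n * (1 - a * q ^ n) := by
  rw [← qPoch_succ', qPoch_succ]

theorem qPoch_eq_mul_tail (a q : ℝ) {k n : ℕ} (h : k ≤ n) :
    qPoch a q n = qPoch a q k * qPoch (a * q ^ k) q (n - k) := by
  rw [← qPoch_add, Nat.add_sub_cancel' h]

theorem qPoch_tail (a q : ℝ) {k n : ℕ} (h : k < n) :
    qPoch (a * q ^ k) q (n - k) = (1 - a * q ^ k) * qPoch (a * q ^ (k + 1)) q (n - (k + 1)) := by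
  obtain ⟨r, rfl⟩ := Nat.exists_eq_add_of_lt h
  rw [show k + r + 1 - k = r + 1 by omega, show k + r + 1 - (k + 1) = r by omega, qPoch_succ',
    pow_succ, mul_assoc]

theorem one_sub_pow_succ_pos (hq0 : 0 < q) (hq1 : q < 1) (n : ℕ) : 0 < 1 - q ^ (n + 1) :=
  sub_pos.2 (pow_lt_one₀ hq0.le hq1 n.succ_ne_zero)

theorem one_sub_mul_pow_pos {a : ℝ} (hq0 : 0 < q) (hq1 : q < 1) (ha : a < 1) (n : ℕ) :
    0 < 1 - a * q ^ n := by
  have hpos : 0 < q ^ n := pow_pos hq0 n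
  have hle : q ^ n ≤ 1 := pow_le_one₀ hq0.le hq1.le
  rcases le_or_gt a 0 with _ | _ <;> nlinarith

theorem qPoch_pos {a : ℝ} (hq0 : 0 < q) (hq1 : q < 1) (ha : a < 1) (n : ℕ) : 0 < qPoch a q n :=
  Finset.prod_pos fun i _ => one_sub_mul_pow_pos hq0 hq1 ha i

theorem one_sub_inv_pow_mul_pow_ne_zero (hq0 : 0 < q) (hq1 : q < 1) {k n : ℕ} (h : k < n) :
    1 - (q ^ n)⁻¹ * q ^ k ≠ 0 := by
  have hlt : q ^ n < q ^ k := pow_lt_pow_right_of_lt_one₀ hq0 hq1 h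
  rw [inv_mul_eq_div]
  exact (sub_neg.2 ((one_lt_div (pow_pos hq0 n)).2 hlt)).ne

theorem qPoch_inv_pow_eq_zero (hq : q ≠ 0) {n k : ℕ} (h : n < k) : qPoch (q ^ n)⁻¹ q k = 0 :=
  Finset.prod_eq_zero (Finset.mem_range.2 h) (by rw [inv_mul_cancel₀ (pow_ne_zero n hq), sub_self])

theorem qPoch_inv_pow_ne_zero (hq0 : 0 < q) (hq1 : q < 1) {n k : ℕ} (h : k ≤ n) :
    qPoch (q ^ n)⁻¹ q k ≠ 0 :=
  Finset.prod_ne_zero_iff.2 fun _ hi =>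
    one_sub_inv_pow_mul_pow_ne_zero hq0 hq1 ((Finset.mem_range.1 hi).trans_le h)

theorem qPoch_inv_pow_self (hq : q ≠ 0) (n : ℕ) :
    qPoch (q ^ n)⁻¹ q n * q ^ (n + 1).choose 2 = (-1) ^ n * qPoch q q n := by
  induction n with
  | zero => simp
  | succ n ih =>
    have hshift : (q ^ (n + 1))⁻¹ * q = (q ^ n)⁻¹ := by rw [pow_succ]; field_simp
    have hchoose : (n + 1 + 1).choose 2 = (n + 1).choose 2 + (n + 1) := by
      rw [Nat.choose_succ_succ', Nat.choose_one_right, add_comm]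
    rw [qPoch_succ', qPoch_succ q, hshift, hchoose, pow_succ (-1 : ℝ), ← pow_succ' q]
    calc (1 - (q ^ (n + 1))⁻¹) * qPoch (q ^ n)⁻¹ q n * q ^ ((n + 1).choose 2 + (n + 1))
        = qPoch (q ^ n)⁻¹ q n * q ^ (n + 1).choose 2 * (q ^ (n + 1) - 1) := by
          rw [pow_add q ((n + 1).choose 2)]; field_simp
      _ = (-1) ^ n * -1 * (qPoch q q n * (1 - q ^ (n + 1))) := by rw [ih]; ring

end qPoch

/-! ### The `q`-Hahn polynomials -/

section hahnPoly

variable {q : ℝ}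

/-- The coefficient of `(q^{-x};q)_k` in the `q`-Hahn polynomial `h_n(x, α, β, N; q)`, where
`A = q^{α+1}`, `D = q^{α+β+1}` and `T = q^N`. -/
def hahnCoeff (q A D T : ℝ) (n k : ℕ) : ℝ :=
  qPoch (A * q ^ k) q (n - k) * qPoch (T⁻¹ * q ^ k) q (n - k) * qPoch (q ^ n)⁻¹ q k *
    qPoch (q ^ n * D) q k / qPoch q q k * q ^ k

/-- The `q`-Hahn polynomial `h_n(x, α, β, N; q)` as a function of `X = q^x` and `T = q^N`, where
`A = q^{α+1}` and `D = q^{α+β+1}`. The terminating series and its prefactors are multiplied out, so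
that no denominator depends on `T`. -/
def hahnPoly (q A D X T : ℝ) (n : ℕ) : ℝ :=
  ∑ k ∈ Finset.range (n + 1), hahnCoeff q A D T n k * qPoch X⁻¹ q k

theorem qHahn_eq_hahnPoly (hq0 : 0 < q) (hq1 : q < 1) {a b : ℝ} (ha : -1 < a) {n N : ℕ}
    (hn : n ≤ N) (x : ℕ) :
    qHahn q n x a b N = hahnPoly q (q ^ (a + 1)) (q ^ (a + b + 1)) (q ^ x) (q ^ N) n := by
  have hA : q ^ (a + 1) < 1 := Real.rpow_lt_one hq0.le hq1 (by linarith)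
  have hD : q ^ ((n : ℝ) + a + b + 1) = q ^ n * q ^ (a + b + 1) := by
    rw [mul_comm, ← Real.rpow_add_natCast hq0.ne']; ring_nf
  unfold qHahn phi32 hahnPoly
  rw [hD, tsum_eq_sum (s := Finset.range (n + 1)), Finset.mul_sum]
  · refine Finset.sum_congr rfl fun k hk => ?_
    have hk : k ≤ n := Nat.lt_succ_iff.1 (Finset.mem_range.1 hk)
    have hAk := (qPoch_pos hq0 hq1 hA k).ne'
    have hNk := qPoch_inv_pow_ne_zero hq0 hq1 (hk.trans hn)
    simp only [Real.rpow_neg_natCast, zpow_neg, zpow_natCast]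
    rw [qPoch_eq_mul_tail (q ^ (a + 1)) q hk, qPoch_eq_mul_tail (q ^ N)⁻¹ q hk, hahnCoeff]
    generalize qPoch (q ^ N)⁻¹ q k = P at hNk ⊢
    field_simp
  · intro k hk
    have hk : n < k := by simpa using hk
    simp [Real.rpow_neg_natCast, qPoch_inv_pow_eq_zero hq0.ne' hk]

theorem hahnPoly_one (q A D T : ℝ) (n : ℕ) :
    hahnPoly q A D 1 T n = qPoch A q n * qPoch T⁻¹ q n := by
  have hvanish : ∀ k, qPoch (1 : ℝ)⁻¹ q (k + 1) = 0 := fun k => by rw [qPoch_succ']; simp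
  rw [hahnPoly, Finset.sum_range_succ', Finset.sum_eq_zero fun k _ => by rw [hvanish, mul_zero]]
  simp [hahnCoeff]

theorem hahnCoeff_mul_div (q A D : ℝ) {T : ℝ} (hT : T ≠ 0) {n k : ℕ} (hk : k ≤ n) :
    hahnCoeff q A D (T / q) n k * (q ^ k - T) = hahnCoeff q A D T n k * (q ^ n - T) := by
  have hshift := one_sub_mul_qPoch (T⁻¹ * q ^ k) q (n - k)
  have hpow : T⁻¹ * q ^ k * q ^ (n - k) = T⁻¹ * q ^ n := by
    rw [mul_assoc, ← pow_add, Nat.add_sub_cancel' hk]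
  have hinv : (T / q)⁻¹ * q ^ k = T⁻¹ * q ^ k * q := by rw [inv_div]; ring
  rw [hpow] at hshift
  have hmul : qPoch (T⁻¹ * q ^ k * q) q (n - k) * (q ^ k - T) =
      qPoch (T⁻¹ * q ^ k) q (n - k) * (q ^ n - T) := by
    linear_combination (-T) * hshift - (q ^ k * qPoch (T⁻¹ * q ^ k * q) q (n - k) -
      q ^ n * qPoch (T⁻¹ * q ^ k) q (n - k)) * mul_inv_cancel₀ hT
  unfold hahnCoeff
  rw [hinv]
  linear_combination qPoch (A * q ^ k) q (n - k) * qPoch (q ^ n)⁻¹ q k *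
    qPoch (q ^ n * D) q k / qPoch q q k * q ^ k * hmul

theorem hahnPoly_raise (q A D : ℝ) {X T : ℝ} (hX : X ≠ 0) (hT : T ≠ 0) (n : ℕ) :
    (1 - X) * hahnPoly q A D (X / q) (T / q) n + (X - T) * hahnPoly q A D X (T / q) n =
      (q ^ n - T) * hahnPoly q A D X T n := by
  simp only [hahnPoly, Finset.mul_sum]
  rw [← Finset.sum_add_distrib]
  refine Finset.sum_congr rfl fun k hk => ?_
  have hT' := hahnCoeff_mul_div q A D hT (Nat.lt_succ_iff.1 (Finset.mem_range.1 hk))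
  have hX' : (1 - X) * qPoch (X / q)⁻¹ q k = (q ^ k - X) * qPoch X⁻¹ q k := by
    have hshift := one_sub_mul_qPoch X⁻¹ q k
    rw [inv_div, div_eq_inv_mul]
    field_simp at hshift ⊢
    linear_combination -hshift
  linear_combination hahnCoeff q A D (T / q) n k * hX' + qPoch X⁻¹ q k * hT'

theorem hahnCoeff_succ (hq0 : 0 < q) (hq1 : q < 1) (A D T : ℝ) {n k : ℕ} (hk : k < n) :
    hahnCoeff q A D T n (k + 1) * (1 - q ^ (k + 1)) * (1 - A * q ^ k) * (1 - T⁻¹ * q ^ k) =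
      hahnCoeff q A D T n k * (1 - (q ^ n)⁻¹ * q ^ k) * (1 - q ^ n * D * q ^ k) * q := by
  have hqk := (qPoch_pos hq0 hq1 hq1 k).ne'
  have hk' := (one_sub_pow_succ_pos hq0 hq1 k).ne'
  rw [pow_succ'] at hk'
  unfold hahnCoeff
  rw [qPoch_tail A q hk, qPoch_tail T⁻¹ q hk, qPoch_succ, qPoch_succ, qPoch_succ, pow_succ' q k]
  field_simp

/-- Summation by parts for the shift `X ↦ q X` in the basis `(X⁻¹;q)_k`. -/
theorem sum_qPoch_shift (hq : q ≠ 0) {X : ℝ} (hX : X ≠ 0) (A : ℝ) (c : ℕ → ℝ) (n : ℕ) :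
    (1 - A * X) * ∑ k ∈ Finset.range (n + 1), c k * qPoch (X * q)⁻¹ q k +
        A * X * ∑ k ∈ Finset.range (n + 1), c k * qPoch X⁻¹ q k =
      (∑ k ∈ Finset.range (n + 1), c k * (q ^ k)⁻¹ * qPoch X⁻¹ q k) -
      ∑ k ∈ Finset.range n,
        c (k + 1) * (1 - q ^ (k + 1)) * (q ^ (k + 1))⁻¹ * (1 - A * q ^ k) * qPoch X⁻¹ q k := by
  induction n with
  | zero => simp; ring
  | succ n ih =>
    have hstep : (1 - A * X) * qPoch (X * q)⁻¹ q (n + 1) + A * X * qPoch X⁻¹ q (n + 1) =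
        (q ^ (n + 1))⁻¹ * qPoch X⁻¹ q (n + 1) -
        (1 - q ^ (n + 1)) * (q ^ (n + 1))⁻¹ * (1 - A * q ^ n) * qPoch X⁻¹ q n := by
      have hinv : (X * q)⁻¹ * q = X⁻¹ := by field_simp
      rw [qPoch_succ', hinv, qPoch_succ X⁻¹ q n]
      field_simp
      ring
    simp only [Finset.sum_range_succ _ (n + 1), Finset.sum_range_succ _ n] at ih ⊢
    linear_combination ih + c (n + 1) * hstep

theorem hahnCoeff_lower (hq0 : 0 < q) (hq1 : q < 1) (A D : ℝ) {T : ℝ} (hT : T ≠ 0) {n k : ℕ}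
    (hk : k < n) (hTk : 1 - (T * q)⁻¹ * q ^ k ≠ 0) :
    hahnCoeff q A D (T * q) n k * (q ^ k)⁻¹ -
        hahnCoeff q A D (T * q) n (k + 1) * (1 - q ^ (k + 1)) * (q ^ (k + 1))⁻¹ * (1 - A * q ^ k) -
        D * (T * q) * hahnCoeff q A D (T * q) n k =
      ((q ^ n)⁻¹ - D * (T * q)) * hahnCoeff q A D T n k := by
  have hq := hq0.ne'
  have hsucc := hahnCoeff_succ hq0 hq1 A D (T * q) hk
  have hdiv := hahnCoeff_mul_div q A D (mul_ne_zero hT hq) hk.le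
  rw [mul_div_cancel_right₀ T hq] at hdiv
  refine mul_right_cancel₀ hTk ?_
  have hdiv' : hahnCoeff q A D T n k * (1 - (T * q)⁻¹ * q ^ k) =
      hahnCoeff q A D (T * q) n k * (1 - (T * q)⁻¹ * q ^ n) := by
    field_simp
    linear_combination -hdiv
  calc
    _ = hahnCoeff q A D (T * q) n k * ((q ^ k)⁻¹ - D * (T * q)) * (1 - (T * q)⁻¹ * q ^ k) -
        (q ^ (k + 1))⁻¹ * (hahnCoeff q A D (T * q) n (k + 1) * (1 - q ^ (k + 1)) *
          (1 - A * q ^ k) * (1 - (T * q)⁻¹ * q ^ k)) := by ring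
    _ = ((q ^ n)⁻¹ - D * (T * q)) * (hahnCoeff q A D (T * q) n k * (1 - (T * q)⁻¹ * q ^ n)) := by
      rw [hsucc]; field_simp; ring
    _ = _ := by rw [← hdiv', mul_assoc]

theorem hahnPoly_lower (hq0 : 0 < q) (hq1 : q < 1) (A D : ℝ) {X T : ℝ} (hX : X ≠ 0) (hT : T ≠ 0)
    {n : ℕ} (hn : ∀ k < n, 1 - (T * q)⁻¹ * q ^ k ≠ 0) :
    (1 - A * X) * hahnPoly q A D (X * q) (T * q) n +
        (A * X - D * (T * q)) * hahnPoly q A D X (T * q) n =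
      ((q ^ n)⁻¹ - D * (T * q)) * hahnPoly q A D X T n := by
  have hshift := sum_qPoch_shift hq0.ne' hX A (hahnCoeff q A D (T * q) n) n
  have hlower : ∑ k ∈ Finset.range n, (hahnCoeff q A D (T * q) n k * (q ^ k)⁻¹ * qPoch X⁻¹ q k -
        hahnCoeff q A D (T * q) n (k + 1) * (1 - q ^ (k + 1)) * (q ^ (k + 1))⁻¹ *
          (1 - A * q ^ k) * qPoch X⁻¹ q k -
        D * (T * q) * (hahnCoeff q A D (T * q) n k * qPoch X⁻¹ q k)) =
      ∑ k ∈ Finset.range n, ((q ^ n)⁻¹ - D * (T * q)) * (hahnCoeff q A D T n k * qPoch X⁻¹ q k) :=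
    Finset.sum_congr rfl fun k hk => by
      have hk := Finset.mem_range.1 hk
      linear_combination
        qPoch X⁻¹ q k * hahnCoeff_lower hq0 hq1 A D hT hk (hn k hk)
  have htop : hahnCoeff q A D (T * q) n n = hahnCoeff q A D T n n := by simp [hahnCoeff]
  simp only [Finset.sum_sub_distrib, ← Finset.mul_sum] at hlower
  simp only [hahnPoly, Finset.sum_range_succ _ n, htop] at hshift ⊢
  linear_combination hshift + hlower

theorem hahnPoly_eq_zero (hq : q ≠ 0) (A D : ℝ) {n x : ℕ} (hx : x ≤ n) :
    hahnPoly q A D (q ^ x) (q ^ n) (n + 1) = 0 := by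
  refine Finset.sum_eq_zero fun k hk => ?_
  rcases (Nat.lt_succ_iff.1 (Finset.mem_range.1 hk)).lt_or_eq with h | rfl
  · have hzero : qPoch ((q ^ n)⁻¹ * q ^ k) q (n + 1 - k) = 0 := by
      refine Finset.prod_eq_zero (i := n - k) (Finset.mem_range.2 (by omega)) ?_
      rw [mul_assoc, ← pow_add, Nat.add_sub_cancel' (Nat.lt_succ_iff.1 h),
        inv_mul_cancel₀ (pow_ne_zero n hq), sub_self]
    rw [hahnCoeff, hzero]
    simp
  · rw [qPoch_inv_pow_eq_zero hq (Nat.lt_succ_iff.2 hx), mul_zero]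

theorem hahnPoly_top (hq0 : 0 < q) (hq1 : q < 1) {A B D : ℝ} (hD : D * q = A * B) (x z : ℕ) :
    hahnPoly q A D (q ^ x) (q ^ (x + z)) (x + z) * (qPoch A q x * qPoch B q z) =
      (-A) ^ x * q ^ x.choose 2 * (qPoch A q (x + z) * qPoch (q ^ (x + z))⁻¹ q (x + z) *
        qPoch B q (x + z)) := by
  induction x generalizing z with
  | zero => simp [hahnPoly_one]
  | succ x ih =>
    have hq := hq0.ne'
    have ih := ih (z + 1)
    rw [← add_assoc, qPoch_succ B q z] at ih
    have hlow : (1 - A * q ^ x) * hahnPoly q A D (q ^ (x + 1)) (q ^ (x + z + 1)) (x + z + 1) =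
        -A * q ^ x * (1 - B * q ^ z) * hahnPoly q A D (q ^ x) (q ^ (x + z + 1)) (x + z + 1) := by
      have h := hahnPoly_lower hq0 hq1 A D (pow_ne_zero x hq) (pow_ne_zero (x + z) hq)
        (n := x + z + 1) fun k hk => by
          rw [← pow_succ]; exact one_sub_inv_pow_mul_pow_ne_zero hq0 hq1 hk
      rw [hahnPoly_eq_zero hq A D (Nat.le_add_right x z), mul_zero, ← pow_succ, ← pow_succ] at h
      linear_combination h + q ^ (x + z) * hahnPoly q A D (q ^ x) (q ^ (x + z + 1)) (x + z + 1) * hD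
    have hchoose : (x + 1).choose 2 = x + x.choose 2 := by
      rw [Nat.choose_succ_succ', Nat.choose_one_right]
    rw [show x + 1 + z = x + z + 1 by omega, qPoch_succ A q x, hchoose, pow_add q x (x.choose 2),
      pow_succ (-A)]
    linear_combination qPoch A q x * qPoch B q z * hlow + (-A * q ^ x) * ih

end hahnPoly

/-! ### The `q`-Vandermonde sum -/

section qVandermonde

variable {q : ℝ}

/-- The summand of the `q`-Vandermonde sum `∑_{x+z=n} q^{x(x-1)} A^x (A q^x;q)_z (B q^z;q)_x /
((q;q)_x (q;q)_z)`, at `p = (x, z)`. -/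
def vandermondeTerm (q A B : ℝ) (p : ℕ × ℕ) : ℝ :=
  (q ^ p.1.choose 2) ^ 2 * A ^ p.1 * qPoch (A * q ^ p.1) q p.2 * qPoch (B * q ^ p.2) q p.1 /
    (qPoch q q p.1 * qPoch q q p.2)

theorem vandermondeTerm_succ_right (hq0 : 0 < q) (hq1 : q < 1) (A B : ℝ) (x z : ℕ) :
    (1 - q ^ (z + 1)) * vandermondeTerm q A B (x, z + 1) =
      (1 - A * q ^ (x + z)) * vandermondeTerm q A (B * q) (x, z) := by
  have hx := (qPoch_pos hq0 hq1 hq1 x).ne'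
  have hz := (qPoch_pos hq0 hq1 hq1 z).ne'
  have hzs := (one_sub_pow_succ_pos hq0 hq1 z).ne'
  simp only [vandermondeTerm]
  rw [qPoch_succ (A * q ^ x), qPoch_succ q q z, ← pow_succ', mul_assoc A, ← pow_add,
    mul_assoc B, ← pow_succ']
  generalize 1 - q ^ (z + 1) = u at hzs ⊢
  field_simp

theorem vandermondeTerm_succ_left (hq0 : 0 < q) (hq1 : q < 1) (A B : ℝ) (x z : ℕ) :
    q ^ z * (1 - q ^ (x + 1)) * vandermondeTerm q A B (x + 1, z) =
      A * q ^ (x + z) * (1 - B * q ^ (x + z)) * vandermondeTerm q (A * q) B (x, z) := by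
  have hx := (qPoch_pos hq0 hq1 hq1 x).ne'
  have hz := (qPoch_pos hq0 hq1 hq1 z).ne'
  have hxs := (one_sub_pow_succ_pos hq0 hq1 x).ne'
  simp only [vandermondeTerm]
  rw [Nat.choose_succ_succ' x 1, Nat.choose_one_right, qPoch_succ (B * q ^ z), qPoch_succ q q x,
    ← pow_succ', mul_assoc B, ← pow_add, mul_assoc A q, ← pow_succ', add_comm z x, mul_pow A q,
    pow_add q x (x.choose 2), pow_add q x z]
  generalize 1 - q ^ (x + 1) = u at hxs ⊢
  field_simp
  ring

theorem sum_vandermondeTerm (hq0 : 0 < q) (hq1 : q < 1) (A B : ℝ) (n : ℕ) :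
    ∑ p ∈ antidiagonal n, vandermondeTerm q A B p =
      qPoch (A * B / q * q ^ n) q n / qPoch q q n := by
  induction n generalizing A B with
  | zero => simp [vandermondeTerm]
  | succ n ih =>
    have hsplit : (1 - q ^ (n + 1)) * ∑ p ∈ antidiagonal (n + 1), vandermondeTerm q A B p =
        ∑ p ∈ antidiagonal (n + 1), (1 - q ^ p.2) * vandermondeTerm q A B p +
        ∑ p ∈ antidiagonal (n + 1), q ^ p.2 * (1 - q ^ p.1) * vandermondeTerm q A B p := by
      rw [Finset.mul_sum, ← Finset.sum_add_distrib]
      refine Finset.sum_congr rfl fun p hp => ?_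
      rw [← mem_antidiagonal.1 hp, pow_add]
      ring
    have hright : ∑ p ∈ antidiagonal (n + 1), (1 - q ^ p.2) * vandermondeTerm q A B p =
        (1 - A * q ^ n) * ∑ p ∈ antidiagonal n, vandermondeTerm q A (B * q) p := by
      rw [Finset.Nat.sum_antidiagonal_succ', Finset.mul_sum, pow_zero, sub_self, zero_mul, zero_add]
      refine Finset.sum_congr rfl fun p hp => ?_
      rw [← mem_antidiagonal.1 hp, vandermondeTerm_succ_right hq0 hq1]
    have hleft : ∑ p ∈ antidiagonal (n + 1), q ^ p.2 * (1 - q ^ p.1) * vandermondeTerm q A B p =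
        A * q ^ n * (1 - B * q ^ n) * ∑ p ∈ antidiagonal n, vandermondeTerm q (A * q) B p := by
      rw [Finset.Nat.sum_antidiagonal_succ, Finset.mul_sum, pow_zero, sub_self, mul_zero, zero_mul,
        zero_add]
      refine Finset.sum_congr rfl fun p hp => ?_
      rw [← mem_antidiagonal.1 hp, vandermondeTerm_succ_left hq0 hq1]
    have hn := (one_sub_pow_succ_pos hq0 hq1 n).ne'
    have hqn := (qPoch_pos hq0 hq1 hq1 n).ne'
    have hshift : A * (B * q) / q * q ^ n = A * B / q * q ^ (n + 1) := by field_simp; ring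
    have hshift' : A * q * B / q * q ^ n = A * B / q * q ^ (n + 1) := by field_simp; ring
    refine mul_left_cancel₀ hn ?_
    rw [hsplit, hright, hleft, ih, ih, hshift, hshift', qPoch_succ, qPoch_succ q q n, ← pow_succ' q]
    generalize 1 - q ^ (n + 1) = u at hn ⊢
    generalize qPoch (A * B / q * q ^ (n + 1)) q n = P
    field_simp
    ring

end qVandermonde

/-! ### Weights, norms and matrix elements -/

section weights

variable {q a b : ℝ}

theorem rpow_add_one_mul_rpow_add_one (hq0 : 0 < q) (a b : ℝ) :
    q ^ (a + 1) * q ^ (b + 1) = q ^ (a + b + 1) * q := by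
  rw [← Real.rpow_add hq0, ← Real.rpow_add_one hq0.ne']
  ring_nf

theorem rpow_add_one_lt_one (hq0 : 0 < q) (hq1 : q < 1) (ha : -1 < a) : q ^ (a + 1) < 1 :=
  Real.rpow_lt_one hq0.le hq1 (by linarith)

theorem rpow_mul_pow_succ_lt_one (hq0 : 0 < q) (hq1 : q < 1) (ha : -1 < a) (n : ℕ) :
    q ^ a * q ^ (n + 1) < 1 := by
  rw [← Real.rpow_add_natCast hq0.ne']
  exact Real.rpow_lt_one hq0.le hq1 (by push_cast; linarith [n.cast_nonneg (α := ℝ)])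

theorem one_sub_rpow_mul_pow_ne_zero (hq0 : 0 < q) (hq1 : q < 1) (ha : -1 < a) (ha0 : a ≠ 0)
    (n : ℕ) : 1 - q ^ a * q ^ n ≠ 0 := by
  rcases n with _ | n
  · rw [pow_zero, mul_one, sub_ne_zero, ne_comm, ← Real.rpow_zero q, Ne,
      Real.rpow_right_inj hq0 hq1.ne]
    exact ha0
  · exact (sub_pos.2 (rpow_mul_pow_succ_lt_one hq0 hq1 ha n)).ne'

theorem qPoch_mul_div_div {D : ℝ} (hD : ∀ i : ℕ, 1 - D * q ^ i ≠ 0) (n r : ℕ) :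
    qPoch (D * q) q (2 * n + r) * ((1 - D) / (1 - D * q ^ (2 * n))) / qPoch D q n =
      qPoch (D * q ^ n) q n * qPoch (D * q ^ (2 * n + 1)) q r := by
  have hn : qPoch D q n ≠ 0 := Finset.prod_ne_zero_iff.2 fun i _ => hD i
  rw [div_eq_iff hn, ← mul_div_assoc, div_eq_iff (hD _), mul_comm, ← qPoch_succ', add_right_comm,
    qPoch_add, qPoch_succ, two_mul, qPoch_add]
  ring

theorem omega_add (hq0 : 0 < q) (a b : ℝ) (x z : ℕ) :
    omega q x a b (x + z) = qPoch (q ^ (a + 1)) q x * qPoch (q ^ (b + 1)) q z /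
      (qPoch q q x * qPoch q q z) * (q ^ (a + 1)) ^ z := by
  rw [omega, Nat.add_sub_cancel_left, ← Real.rpow_mul_natCast hq0.le]
  push_cast
  ring_nf

theorem omega_pos (hq0 : 0 < q) (hq1 : q < 1) (ha : -1 < a) (hb : -1 < b) (x z : ℕ) :
    0 < omega q x a b (x + z) := by
  have hx := qPoch_pos hq0 hq1 hq1 x
  have hz := qPoch_pos hq0 hq1 hq1 z
  have hA := qPoch_pos hq0 hq1 (rpow_add_one_lt_one hq0 hq1 ha) x
  have hB := qPoch_pos hq0 hq1 (rpow_add_one_lt_one hq0 hq1 hb) z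
  rw [omega_add hq0]
  positivity

theorem omega_succ_left (hq0 : 0 < q) (hq1 : q < 1) (a b : ℝ) (x z : ℕ) :
    omega q (x + 1) a b (x + z + 1) * (1 - q ^ (x + 1)) =
      omega q x a b (x + z) * (1 - q ^ (a + 1) * q ^ x) := by
  have hx := (one_sub_pow_succ_pos hq0 hq1 x).ne'
  rw [add_right_comm, omega_add hq0, omega_add hq0, qPoch_succ, qPoch_succ q q, ← pow_succ']
  generalize 1 - q ^ (x + 1) = u at hx ⊢
  field_simp

theorem omega_succ_right (hq0 : 0 < q) (hq1 : q < 1) (a b : ℝ) (x z : ℕ) :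
    omega q x a b (x + z + 1) * (1 - q ^ (z + 1)) =
      omega q x a b (x + z) * (1 - q ^ (b + 1) * q ^ z) * q ^ (a + 1) := by
  have hz := (one_sub_pow_succ_pos hq0 hq1 z).ne'
  rw [add_assoc, omega_add hq0, omega_add hq0, qPoch_succ, qPoch_succ q q, ← pow_succ']
  generalize 1 - q ^ (z + 1) = u at hz ⊢
  field_simp
  ring

/-- The factor `1 - q^{α+β+1}` of `η` cancels the first factor of `(q^{α+β+1};q)_n` for `n ≥ 1`,
and the factor `1 - q^{2n+α+β+1}` for `n = 0`; the latter would be `0 / 0` if `α + β + 1 = 0`. -/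
theorem eta_add (hq0 : 0 < q) (hq1 : q < 1) (ha : -1 < a) (hb : -1 < b) (hab : a + b + 1 ≠ 0)
    (n r : ℕ) :
    eta q n a b (n + r) =
      qPoch (q ^ (a + b + 1) * q ^ n) q n * qPoch (q ^ (a + b + 1) * q ^ (2 * n + 1)) q r /
        qPoch q q r * ((q ^ ((n + 1).choose 2 + n * r)) ^ 2)⁻¹ *
        (qPoch q q n * qPoch (q ^ (a + 1)) q n * qPoch (q ^ (b + 1)) q n) * (q ^ (a + 1)) ^ n := by
  have hD (i : ℕ) : 1 - q ^ (a + b + 1) * q ^ i ≠ 0 :=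
    one_sub_rpow_mul_pow_ne_zero hq0 hq1 (by linarith) hab i
  have hpoch : q ^ (a + b + 2) = q ^ (a + b + 1) * q := by
    rw [← Real.rpow_add_one hq0.ne']; ring_nf
  have htop : q ^ (2 * (n : ℝ) + a + b + 1) = q ^ (a + b + 1) * q ^ (2 * n) := by
    rw [← Real.rpow_add_natCast hq0.ne']; push_cast; ring_nf
  have hpow : q ^ (2 * (n.choose 2 : ℝ) - 2 * ((n + r : ℕ) : ℝ) * n) =
      ((q ^ ((n + 1).choose 2 + n * r)) ^ 2)⁻¹ := by
    rw [← pow_mul, ← zpow_natCast, ← zpow_neg, ← Real.rpow_neg_natCast]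
    push_cast [Nat.cast_choose_two]
    ring_nf
  have hlast : q ^ ((n : ℝ) * (a + 1)) = (q ^ (a + 1)) ^ n := by
    rw [← Real.rpow_mul_natCast hq0.le, mul_comm]
  rw [eta, hpoch, htop, hpow, hlast, Nat.add_sub_cancel_left, ← add_assoc, ← two_mul,
    ← qPoch_mul_div_div hD]
  ring

theorem eta_pos (hq0 : 0 < q) (hq1 : q < 1) (ha : -1 < a) (hb : -1 < b) (hab : a + b + 1 ≠ 0)
    (n r : ℕ) : 0 < eta q n a b (n + r) := by
  have hD (i : ℕ) : q ^ (a + b + 1) * q ^ (i + 1) < 1 :=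
    rpow_mul_pow_succ_lt_one hq0 hq1 (by linarith) i
  have hDn : 0 < qPoch (q ^ (a + b + 1) * q ^ n) q n := by
    rcases n with _ | n
    · simp
    · exact qPoch_pos hq0 hq1 (hD n) _
  have hn := qPoch_pos hq0 hq1 hq1 n
  have hr := qPoch_pos hq0 hq1 hq1 r
  have hA := qPoch_pos hq0 hq1 (rpow_add_one_lt_one hq0 hq1 ha) n
  have hB := qPoch_pos hq0 hq1 (rpow_add_one_lt_one hq0 hq1 hb) n
  have hDr := qPoch_pos hq0 hq1 (hD (2 * n)) r
  rw [eta_add hq0 hq1 ha hb hab]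
  positivity

theorem eta_succ (hq0 : 0 < q) (hq1 : q < 1) (ha : -1 < a) (hb : -1 < b) (hab : a + b + 1 ≠ 0)
    (n r : ℕ) :
    eta q n a b (n + r + 1) * ((1 - q ^ (r + 1)) * (q ^ n) ^ 2) =
      eta q n a b (n + r) * (1 - q ^ (a + b + 1) * q ^ (2 * n + r + 1)) := by
  have hr := (one_sub_pow_succ_pos hq0 hq1 r).ne'
  rw [add_assoc n, eta_add hq0 hq1 ha hb hab, eta_add hq0 hq1 ha hb hab, qPoch_succ,
    qPoch_succ q q r, ← pow_succ', mul_assoc (q ^ (a + b + 1)), ← pow_add, mul_add n, mul_one,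
    ← add_assoc, pow_add q _ n, add_right_comm _ 1 r]
  generalize 1 - q ^ (r + 1) = u at hr ⊢
  field_simp

end weights

/-! ### The ladder relations of the `q`-Hahn functions -/

section ladderRelations

variable {q a b : ℝ}

/-- The normalization `q^{1/2} / (1 - q)^2` of the matrix elements `σ_n`. -/
def sigmaScale (q : ℝ) : ℝ := q ^ (1 / 2 : ℝ) / (1 - q) ^ 2

theorem sigmaScale_pos (hq0 : 0 < q) (hq1 : q < 1) : 0 < sigmaScale q :=
  div_pos (Real.rpow_pos_of_pos hq0 _) (pow_pos (sub_pos.2 hq1) 2)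

@[simp]
theorem sigma_zero (q a : ℝ) : sigma q a 0 = 0 := by simp [sigma]

theorem sigma_succ (hq0 : 0 < q) (a : ℝ) (n : ℕ) :
    sigma q a (n + 1) = sigmaScale q * (1 - q ^ (n + 1)) * (1 - q ^ (a + 1) * q ^ n) := by
  have hpow : q ^ (((n + 1 : ℕ) : ℝ) + a) = q ^ (a + 1) * q ^ n := by
    rw [← Real.rpow_add_natCast hq0.ne']; push_cast; ring_nf
  rw [sigma, sigmaScale, hpow]
  ring

theorem sigma_succ_pos (hq0 : 0 < q) (hq1 : q < 1) (ha : -1 < a) (n : ℕ) :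
    0 < sigma q a (n + 1) := by
  rw [sigma_succ hq0]
  exact mul_pos (mul_pos (sigmaScale_pos hq0 hq1) (one_sub_pow_succ_pos hq0 hq1 n))
    (one_sub_mul_pow_pos hq0 hq1 (rpow_add_one_lt_one hq0 hq1 ha) n)

theorem sqrt_mul_sqrt_of_mul_eq_mul {s u v X Y : ℝ} (hs : 0 ≤ s) (hu : 0 ≤ u) (hv : 0 ≤ v)
    (h : X * u = Y * v) : √(s * u * v) * √X = √s * √Y * v := by
  have hsq : u * v * X = Y * v ^ 2 := by linear_combination v * h
  rw [mul_assoc, Real.sqrt_mul hs, mul_assoc, ← Real.sqrt_mul (mul_nonneg hu hv), hsq,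
    Real.sqrt_mul' _ (sq_nonneg v), Real.sqrt_sq hv, mul_assoc]

theorem sqrt_sigma_mul_sqrt_omega_succ_left (hq0 : 0 < q) (hq1 : q < 1) (ha : -1 < a) (b : ℝ)
    (x z : ℕ) :
    √(sigma q a (x + 1)) * √(omega q (x + 1) a b (x + z + 1)) =
      √(sigmaScale q) * √(omega q x a b (x + z)) * (1 - q ^ (a + 1) * q ^ x) := by
  rw [sigma_succ hq0]
  exact sqrt_mul_sqrt_of_mul_eq_mul (sigmaScale_pos hq0 hq1).le (one_sub_pow_succ_pos hq0 hq1 x).le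
    (one_sub_mul_pow_pos hq0 hq1 (rpow_add_one_lt_one hq0 hq1 ha) x).le
    (omega_succ_left hq0 hq1 a b x z)

theorem sqrt_sigma_mul_sqrt_omega_left (hq0 : 0 < q) (hq1 : q < 1) (ha : -1 < a) (b : ℝ)
    (x z : ℕ) :
    √(sigma q a (x + 1)) * √(omega q x a b (x + z)) =
      √(sigmaScale q) * √(omega q (x + 1) a b (x + z + 1)) * (1 - q ^ (x + 1)) := by
  rw [sigma_succ hq0, mul_right_comm]
  exact sqrt_mul_sqrt_of_mul_eq_mul (sigmaScale_pos hq0 hq1).le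
    (one_sub_mul_pow_pos hq0 hq1 (rpow_add_one_lt_one hq0 hq1 ha) x).le
    (one_sub_pow_succ_pos hq0 hq1 x).le (omega_succ_left hq0 hq1 a b x z).symm

theorem rpow_level (hq0 : 0 < q) (a : ℝ) (x : ℕ) :
    q ^ ((x : ℝ) + (a + 1) / 2) = √(q ^ (a + 1)) * q ^ x := by
  rw [Real.sqrt_eq_rpow, ← Real.rpow_mul hq0.le, ← Real.rpow_add_natCast hq0.ne']
  ring_nf

theorem sqrt_sigma_mul_sqrt_omega_succ_right (hq0 : 0 < q) (hq1 : q < 1) (hb : -1 < b) (a : ℝ)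
    (x z : ℕ) :
    q ^ ((x : ℝ) + (a + 1) / 2) * √(sigma q b (z + 1)) * √(omega q x a b (x + z + 1)) =
      √(sigmaScale q) * √(omega q x a b (x + z)) *
        (q ^ (a + 1) * q ^ x * (1 - q ^ (b + 1) * q ^ z)) := by
  have hA : 0 ≤ q ^ (a + 1) := Real.rpow_nonneg hq0.le _
  have hsqrt := sqrt_mul_sqrt_of_mul_eq_mul (sigmaScale_pos hq0 hq1).le
    (one_sub_pow_succ_pos hq0 hq1 z).le
    (one_sub_mul_pow_pos hq0 hq1 (rpow_add_one_lt_one hq0 hq1 hb) z).le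
    ((omega_succ_right hq0 hq1 a b x z).trans (mul_right_comm _ _ _))
  rw [Real.sqrt_mul' _ hA] at hsqrt
  rw [sigma_succ hq0, rpow_level hq0, mul_assoc, hsqrt]
  linear_combination √(sigmaScale q) * √(omega q x a b (x + z)) *
    (1 - q ^ (b + 1) * q ^ z) * q ^ x * Real.mul_self_sqrt hA

theorem sqrt_sigma_mul_sqrt_omega_right (hq0 : 0 < q) (hq1 : q < 1) (hb : -1 < b) (a : ℝ)
    (x z : ℕ) :
    q ^ ((x : ℝ) + (a + 1) / 2) * √(sigma q b (z + 1)) * √(omega q x a b (x + z)) =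
      √(sigmaScale q) * √(omega q x a b (x + z + 1)) * (q ^ x * (1 - q ^ (z + 1))) := by
  have hsqrt := sqrt_mul_sqrt_of_mul_eq_mul (sigmaScale_pos hq0 hq1).le
    (one_sub_mul_pow_pos hq0 hq1 (rpow_add_one_lt_one hq0 hq1 hb) z).le
    (one_sub_pow_succ_pos hq0 hq1 z).le
    ((omega_succ_right hq0 hq1 a b x z).trans (mul_right_comm _ _ _)).symm
  rw [Real.sqrt_mul' _ (Real.rpow_nonneg hq0.le _)] at hsqrt
  rw [sigma_succ hq0, mul_right_comm (sigmaScale q), rpow_level hq0]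
  linear_combination q ^ x * hsqrt

theorem sigma_coupled_succ (hq0 : 0 < q) (a b : ℝ) (n r : ℕ) :
    sigma q (a + b + 1 + 2 * n) (r + 1) = sigmaScale q * (1 - q ^ (r + 1)) *
      (1 - q ^ (a + b + 1) * q ^ (2 * n + r + 1)) := by
  have hpow : q ^ (a + b + 1 + 2 * n + 1) = q ^ (a + b + 1) * q ^ (2 * n + 1) := by
    rw [← Real.rpow_add_natCast hq0.ne']; push_cast; ring_nf
  rw [sigma_succ hq0, hpow, add_right_comm _ r, pow_add q _ r, mul_assoc (q ^ (a + b + 1))]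

theorem sqrt_sigma_coupled_mul_sqrt_eta (hq0 : 0 < q) (hq1 : q < 1) (ha : -1 < a) (hb : -1 < b)
    (hab : a + b + 1 ≠ 0) (n r : ℕ) :
    √(sigma q (a + b + 1 + 2 * n) (r + 1)) * √(eta q n a b (n + r)) =
      √(sigmaScale q) * √(eta q n a b (n + r + 1)) * (q ^ n - q ^ (n + r + 1)) := by
  have hD : q ^ (a + b + 1) * q ^ (2 * n + r + 1) < 1 :=
    rpow_mul_pow_succ_lt_one hq0 hq1 (by linarith) _
  have hsqrt := sqrt_mul_sqrt_of_mul_eq_mul (X := eta q n a b (n + r))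
    (Y := eta q n a b (n + r + 1) * (q ^ n) ^ 2)
    (sigmaScale_pos hq0 hq1).le (sub_pos.2 hD).le (one_sub_pow_succ_pos hq0 hq1 r).le
    (by linear_combination -eta_succ hq0 hq1 ha hb hab n r)
  rw [Real.sqrt_mul' _ (sq_nonneg _), Real.sqrt_sq (pow_pos hq0 n).le] at hsqrt
  rw [sigma_coupled_succ hq0, mul_right_comm (sigmaScale q), hsqrt]
  ring

theorem sqrt_sigma_coupled_mul_sqrt_eta_succ (hq0 : 0 < q) (hq1 : q < 1) (ha : -1 < a)
    (hb : -1 < b) (hab : a + b + 1 ≠ 0) (n r : ℕ) :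
    √(sigma q (a + b + 1 + 2 * n) (r + 1)) * √(eta q n a b (n + r + 1)) =
      √(sigmaScale q) * √(eta q n a b (n + r)) *
        ((q ^ n)⁻¹ - q ^ (a + b + 1) * q ^ (n + r + 1)) := by
  have hq : q ^ n ≠ 0 := (pow_pos hq0 n).ne'
  have hD : q ^ (a + b + 1) * q ^ (2 * n + r + 1) < 1 :=
    rpow_mul_pow_succ_lt_one hq0 hq1 (by linarith) _
  have hsqrt := sqrt_mul_sqrt_of_mul_eq_mul (X := eta q n a b (n + r + 1) * (q ^ n) ^ 2)
    (Y := eta q n a b (n + r))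
    (sigmaScale_pos hq0 hq1).le (one_sub_pow_succ_pos hq0 hq1 r).le (sub_pos.2 hD).le
    (by linear_combination eta_succ hq0 hq1 ha hb hab n r)
  rw [Real.sqrt_mul' _ (sq_nonneg _), Real.sqrt_sq (pow_pos hq0 n).le] at hsqrt
  refine mul_right_cancel₀ hq ?_
  rw [sigma_coupled_succ hq0, mul_assoc, hsqrt, mul_assoc (_ * _), sub_mul, inv_mul_cancel₀ hq]
  ring

theorem qHahnHat_eq (hq0 : 0 < q) (hq1 : q < 1) (ha : -1 < a) (hb : -1 < b) {n x N : ℕ}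
    (hx : x ≤ N) (hn : n ≤ N) :
    qHahnHat q n x a b N = √(omega q x a b N) / √(eta q n a b N) *
      hahnPoly q (q ^ (a + 1)) (q ^ (a + b + 1)) (q ^ x) (q ^ N) n := by
  obtain ⟨z, rfl⟩ := Nat.exists_eq_add_of_le hx
  rw [qHahnHat, if_pos ⟨by positivity, by exact_mod_cast hx, by exact_mod_cast hn⟩]
  simp only [Int.toNat_natCast]
  rw [qHahn_eq_hahnPoly hq0 hq1 ha hn, Real.sqrt_div (omega_pos hq0 hq1 ha hb x z).le]

theorem sqrt_sigma_mul_qHahnHat_left (hq0 : 0 < q) (hq1 : q < 1) (ha : -1 < a) (hb : -1 < b)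
    {n x z N : ℕ} (hn : n ≤ N) (h : x + z = N + 1) :
    √(sigma q a x) * qHahnHat q n ((x : ℤ) - 1) a b N =
      √(sigmaScale q) * √(omega q x a b (N + 1)) / √(eta q n a b N) * ((1 - q ^ x) *
        hahnPoly q (q ^ (a + 1)) (q ^ (a + b + 1)) (q ^ x / q) (q ^ N) n) := by
  rcases x with _ | x
  · simp
  · obtain rfl : x + z = N := by omega
    rw [Nat.cast_succ, add_sub_cancel_right, qHahnHat_eq hq0 hq1 ha hb (by omega) hn, pow_succ,
      mul_div_cancel_right₀ _ hq0.ne', ← pow_succ]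
    linear_combination hahnPoly q (q ^ (a + 1)) (q ^ (a + b + 1)) (q ^ x) (q ^ (x + z)) n /
      √(eta q n a b (x + z)) * sqrt_sigma_mul_sqrt_omega_left hq0 hq1 ha b x z

theorem sqrt_sigma_mul_qHahnHat_right (hq0 : 0 < q) (hq1 : q < 1) (ha : -1 < a) (hb : -1 < b)
    {n x z N : ℕ} (hn : n ≤ N) (h : x + z = N + 1) :
    q ^ ((x : ℝ) + (a + 1) / 2) * √(sigma q b z) * qHahnHat q n x a b N =
      √(sigmaScale q) * √(omega q x a b (N + 1)) / √(eta q n a b N) * ((q ^ x - q ^ (N + 1)) *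
        hahnPoly q (q ^ (a + 1)) (q ^ (a + b + 1)) (q ^ x) (q ^ N) n) := by
  rcases z with _ | z
  · obtain rfl : x = N + 1 := h
    simp
  · obtain rfl : x + z = N := by omega
    have hdiff : q ^ x - q ^ (x + z + 1) = q ^ x * (1 - q ^ (z + 1)) := by ring
    rw [qHahnHat_eq hq0 hq1 ha hb (by omega) hn, hdiff]
    linear_combination hahnPoly q (q ^ (a + 1)) (q ^ (a + b + 1)) (q ^ x) (q ^ (x + z)) n /
      √(eta q n a b (x + z)) * sqrt_sigma_mul_sqrt_omega_right hq0 hq1 hb a x z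

theorem qHahnHat_raise (hq0 : 0 < q) (hq1 : q < 1) (ha : -1 < a) (hb : -1 < b)
    (hab : a + b + 1 ≠ 0) {n r x z N : ℕ} (hN : n + r = N) (h : x + z = N + 1) :
    √(sigma q a x) * qHahnHat q n ((x : ℤ) - 1) a b N +
        q ^ ((x : ℝ) + (a + 1) / 2) * √(sigma q b z) * qHahnHat q n x a b N =
      √(sigma q (a + b + 1 + 2 * n) (r + 1)) * qHahnHat q n x a b (N + 1 : ℕ) := by
  obtain rfl := hN
  have hη := (Real.sqrt_pos.2 (eta_pos hq0 hq1 ha hb hab n r)).ne'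
  have hη' := (Real.sqrt_pos.2 (eta_pos hq0 hq1 ha hb hab n (r + 1))).ne'
  have hdiv : q ^ (n + r + 1) / q = q ^ (n + r) := by rw [pow_succ, mul_div_cancel_right₀ _ hq0.ne']
  have hraise := hahnPoly_raise q (q ^ (a + 1)) (q ^ (a + b + 1)) (pow_ne_zero x hq0.ne')
    (pow_ne_zero (n + r + 1) hq0.ne') n
  have hsqrt := sqrt_sigma_coupled_mul_sqrt_eta hq0 hq1 ha hb hab n r
  rw [hdiv] at hraise
  rw [sqrt_sigma_mul_qHahnHat_left hq0 hq1 ha hb (by omega) h,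
    sqrt_sigma_mul_qHahnHat_right hq0 hq1 ha hb (by omega) h, ← mul_add, hraise,
    qHahnHat_eq hq0 hq1 ha hb (by omega) (by omega)]
  rw [← add_assoc] at hη'
  field_simp
  linear_combination -hahnPoly q (q ^ (a + 1)) (q ^ (a + b + 1)) (q ^ x) (q ^ (n + r + 1)) n *
    √(omega q x a b (n + r + 1)) * hsqrt

theorem qHahnHat_lower (hq0 : 0 < q) (hq1 : q < 1) (ha : -1 < a) (hb : -1 < b)
    (hab : a + b + 1 ≠ 0) {n r x z N : ℕ} (hN : n + r = N + 1) (h : x + z = N) :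
    √(sigma q a (x + 1)) * qHahnHat q n (x + 1 : ℕ) a b (N + 1 : ℕ) +
        q ^ ((x : ℝ) + (a + 1) / 2) * √(sigma q b (z + 1)) * qHahnHat q n x a b (N + 1 : ℕ) =
      √(sigma q (a + b + 1 + 2 * n) r) * qHahnHat q n x a b N := by
  obtain rfl := h
  have hη := (Real.sqrt_pos.2 (eta_pos hq0 hq1 ha hb hab n r)).ne'
  have hlow := hahnPoly_lower hq0 hq1 (q ^ (a + 1)) (q ^ (a + b + 1)) (pow_ne_zero x hq0.ne')
    (pow_ne_zero (x + z) hq0.ne') (n := n) fun k hk => by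
      rw [← pow_succ]
      exact one_sub_inv_pow_mul_pow_ne_zero hq0 hq1 (by omega)
  rw [← pow_succ, ← pow_succ] at hlow
  have hcoef : q ^ (a + 1) * q ^ x * (1 - q ^ (b + 1) * q ^ z) =
      q ^ (a + 1) * q ^ x - q ^ (a + b + 1) * q ^ (x + z + 1) := by
    rw [pow_succ, pow_add]
    linear_combination -q ^ x * q ^ z * rpow_add_one_mul_rpow_add_one hq0 a b
  have hsum : √(sigma q a (x + 1)) * qHahnHat q n (x + 1 : ℕ) a b (x + z + 1 : ℕ) +
        q ^ ((x : ℝ) + (a + 1) / 2) * √(sigma q b (z + 1)) *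
          qHahnHat q n x a b (x + z + 1 : ℕ) =
      √(sigmaScale q) * √(omega q x a b (x + z)) / √(eta q n a b (x + z + 1)) *
        (((q ^ n)⁻¹ - q ^ (a + b + 1) * q ^ (x + z + 1)) *
          hahnPoly q (q ^ (a + 1)) (q ^ (a + b + 1)) (q ^ x) (q ^ (x + z)) n) := by
    rw [← hlow, ← hcoef, qHahnHat_eq hq0 hq1 ha hb (by omega) (by omega),
      qHahnHat_eq hq0 hq1 ha hb (by omega) (by omega)]
    linear_combination
      hahnPoly q (q ^ (a + 1)) (q ^ (a + b + 1)) (q ^ (x + 1)) (q ^ (x + z + 1)) n /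
        √(eta q n a b (x + z + 1)) * sqrt_sigma_mul_sqrt_omega_succ_left hq0 hq1 ha b x z +
      hahnPoly q (q ^ (a + 1)) (q ^ (a + b + 1)) (q ^ x) (q ^ (x + z + 1)) n /
        √(eta q n a b (x + z + 1)) * sqrt_sigma_mul_sqrt_omega_succ_right hq0 hq1 hb a x z
  rw [hsum]
  rcases r with _ | r
  · obtain rfl : n = x + z + 1 := by omega
    rw [hahnPoly_eq_zero hq0.ne' _ _ (by omega)]
    simp
  · have hxz : x + z = n + r := by omega
    have hη' := (Real.sqrt_pos.2 (eta_pos hq0 hq1 ha hb hab n r)).ne'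
    have hsqrt := sqrt_sigma_coupled_mul_sqrt_eta_succ hq0 hq1 ha hb hab n r
    rw [qHahnHat_eq hq0 hq1 ha hb (by omega) (by omega)]
    rw [← hxz] at hsqrt hη'
    rw [hN] at hη
    generalize (q ^ n)⁻¹ - q ^ (a + b + 1) * q ^ (x + z + 1) = k at hsqrt ⊢
    field_simp
    linear_combination -hahnPoly q (q ^ (a + 1)) (q ^ (a + b + 1)) (q ^ x) (q ^ (x + z)) n *
      √(omega q x a b (x + z)) * hsqrt

end ladderRelations

/-! ### Orthonormality of the `q`-Hahn functions -/

section orthonormality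

variable {q a b : ℝ}

theorem qHahnHat_top_mul_self (hq0 : 0 < q) (hq1 : q < 1) (ha : -1 < a) (hb : -1 < b)
    (hab : a + b + 1 ≠ 0) {n : ℕ} {p : ℕ × ℕ} (hp : p ∈ antidiagonal n) :
    qHahnHat q n p.1 a b n * qHahnHat q n p.1 a b n =
      (q ^ (a + 1)) ^ n * qPoch (q ^ (a + 1)) q n * qPoch (q ^ (b + 1)) q n *
        qPoch (q ^ n)⁻¹ q n ^ 2 / eta q n a b n *
        vandermondeTerm q (q ^ (a + 1)) (q ^ (b + 1)) p := by
  obtain ⟨x, z⟩ := p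
  obtain rfl : x + z = n := mem_antidiagonal.1 hp
  have hAx := (qPoch_pos hq0 hq1 (rpow_add_one_lt_one hq0 hq1 ha) x).ne'
  have hBz := (qPoch_pos hq0 hq1 (rpow_add_one_lt_one hq0 hq1 hb) z).ne'
  have hx := (qPoch_pos hq0 hq1 hq1 x).ne'
  have hz := (qPoch_pos hq0 hq1 hq1 z).ne'
  have hη : 0 < eta q (x + z) a b (x + z) := eta_pos hq0 hq1 ha hb hab (x + z) 0
  have htop := hahnPoly_top hq0 hq1 (rpow_add_one_mul_rpow_add_one hq0 a b).symm x z
  have hB : qPoch (q ^ (b + 1)) q (x + z) =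
      qPoch (q ^ (b + 1)) q z * qPoch (q ^ (b + 1) * q ^ z) q x := by rw [add_comm x, qPoch_add]
  rw [← eq_div_iff (mul_ne_zero hAx hBz)] at htop
  rw [qHahnHat_eq hq0 hq1 ha hb (by omega) le_rfl, htop, mul_mul_mul_comm, div_mul_div_comm,
    Real.mul_self_sqrt (omega_pos hq0 hq1 ha hb x z).le,
    Real.mul_self_sqrt hη.le, omega_add hq0, vandermondeTerm,
    hB, qPoch_add (q ^ (a + 1)), neg_pow (q ^ (a + 1)), pow_add (q ^ (a + 1))]
  have hsign : ((-1 : ℝ) ^ x) ^ 2 = 1 := by rw [← pow_mul, mul_comm, pow_mul, neg_one_sq, one_pow]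
  have hη' := hη.ne'
  field_simp
  rw [hsign, one_mul]

theorem sum_qHahnHat_top (hq0 : 0 < q) (hq1 : q < 1) (ha : -1 < a) (hb : -1 < b)
    (hab : a + b + 1 ≠ 0) (n : ℕ) :
    ∑ p ∈ antidiagonal n, qHahnHat q n p.1 a b n * qHahnHat q n p.1 a b n = 1 := by
  have hη := (eta_pos hq0 hq1 ha hb hab n 0).ne'
  have hqn := (qPoch_pos hq0 hq1 hq1 n).ne'
  have hpow : q ^ (n + 1).choose 2 ≠ 0 := pow_ne_zero _ hq0.ne'
  have hDn : q ^ (a + 1) * q ^ (b + 1) / q = q ^ (a + b + 1) := by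
    rw [rpow_add_one_mul_rpow_add_one hq0, mul_div_cancel_right₀ _ hq0.ne']
  have hηn := eta_add hq0 hq1 ha hb hab n 0
  have hsq : (qPoch (q ^ n)⁻¹ q n * q ^ (n + 1).choose 2) ^ 2 = qPoch q q n ^ 2 := by
    rw [qPoch_inv_pow_self hq0.ne', mul_pow, ← pow_mul, mul_comm n, pow_mul, neg_one_sq, one_pow,
      one_mul]
  simp only [add_zero, mul_zero, qPoch_zero, mul_one, div_one] at hη hηn
  rw [Finset.sum_congr rfl fun p hp => qHahnHat_top_mul_self hq0 hq1 ha hb hab hp,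
    ← Finset.mul_sum, sum_vandermondeTerm hq0 hq1, hDn, div_mul_div_comm,
    div_eq_one_iff_eq (mul_ne_zero hη hqn), hηn]
  generalize qPoch (q ^ n)⁻¹ q n = E at hsq ⊢
  field_simp
  linear_combination qPoch (q ^ (a + 1)) q n * qPoch (q ^ (b + 1)) q n *
    qPoch (q ^ (a + b + 1) * q ^ n) q n * hsq

theorem sum_qHahnHat_succ (hq0 : 0 < q) (hq1 : q < 1) (ha : -1 < a) (hb : -1 < b)
    (hab : a + b + 1 ≠ 0) {n n' r r' N : ℕ} (h : n + r = N) (h' : n' + r' = N + 1) :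
    √(sigma q (a + b + 1 + 2 * n) (r + 1)) *
        ∑ p ∈ antidiagonal (N + 1), qHahnHat q n p.1 a b (N + 1 : ℕ) *
          qHahnHat q n' p.1 a b (N + 1 : ℕ) =
      √(sigma q (a + b + 1 + 2 * n') r') *
        ∑ p ∈ antidiagonal N, qHahnHat q n p.1 a b N * qHahnHat q n' p.1 a b N := by
  have hraise : ∀ p ∈ antidiagonal (N + 1), √(sigma q (a + b + 1 + 2 * n) (r + 1)) *
      (qHahnHat q n p.1 a b (N + 1 : ℕ) * qHahnHat q n' p.1 a b (N + 1 : ℕ)) =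
      √(sigma q a p.1) * qHahnHat q n ((p.1 : ℤ) - 1) a b N * qHahnHat q n' p.1 a b (N + 1 : ℕ) +
      q ^ ((p.1 : ℝ) + (a + 1) / 2) * √(sigma q b p.2) * qHahnHat q n p.1 a b N *
        qHahnHat q n' p.1 a b (N + 1 : ℕ) := fun p hp => by
    rw [← mul_assoc, ← qHahnHat_raise hq0 hq1 ha hb hab h (mem_antidiagonal.1 hp), add_mul]
  rw [Finset.mul_sum, Finset.sum_congr rfl hraise, Finset.sum_add_distrib,
    Finset.Nat.sum_antidiagonal_succ, Finset.Nat.sum_antidiagonal_succ']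
  simp only [sigma_zero, Real.sqrt_zero, zero_mul, mul_zero, zero_add]
  rw [← Finset.sum_add_distrib, Finset.mul_sum]
  refine Finset.sum_congr rfl fun p hp => ?_
  rw [Nat.cast_succ p.1, add_sub_cancel_right]
  have hlower := qHahnHat_lower hq0 hq1 ha hb hab h' (mem_antidiagonal.1 hp)
  rw [Nat.cast_succ p.1] at hlower
  linear_combination qHahnHat q n p.1 a b N * hlower

theorem sum_qHahnHat_mul_of_le (hq0 : 0 < q) (hq1 : q < 1) (ha : -1 < a) (hb : -1 < b)
    (hab : a + b + 1 ≠ 0) {n n' N : ℕ} (h : n ≤ n') (h' : n' ≤ N) :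
    ∑ p ∈ antidiagonal N, qHahnHat q n p.1 a b N * qHahnHat q n' p.1 a b N =
      if n = n' then 1 else 0 := by
  induction N with
  | zero =>
    obtain ⟨rfl, rfl⟩ : n = 0 ∧ n' = 0 := by omega
    simpa using sum_qHahnHat_top hq0 hq1 ha hb hab 0
  | succ N ih =>
    rcases Nat.lt_or_ge N n with hn | hn
    · obtain ⟨rfl, rfl⟩ : n = N + 1 ∧ n' = N + 1 := by omega
      simpa using sum_qHahnHat_top hq0 hq1 ha hb hab (N + 1)
    · obtain ⟨r, rfl⟩ := Nat.exists_eq_add_of_le hn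
      obtain ⟨r', hr'⟩ := Nat.exists_eq_add_of_le h'
      have hσ : 0 < sigma q (a + b + 1 + 2 * n) (r + 1) :=
        sigma_succ_pos hq0 hq1 (by linarith [n.cast_nonneg (α := ℝ)]) r
      refine mul_left_cancel₀ (Real.sqrt_pos.2 hσ).ne' ?_
      rw [sum_qHahnHat_succ hq0 hq1 ha hb hab rfl hr'.symm]
      rcases r' with _ | r'
      · rw [if_neg (by omega)]
        simp
      · rw [ih (by omega)]
        rcases eq_or_ne n n' with rfl | hne
        · obtain rfl : r = r' := by omega
          rfl
        · simp [hne]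

theorem sum_qHahnHat_mul (hq0 : 0 < q) (hq1 : q < 1) (ha : -1 < a) (hb : -1 < b)
    (hab : a + b + 1 ≠ 0) {n n' N : ℕ} (h : n ≤ N) (h' : n' ≤ N) :
    ∑ p ∈ antidiagonal N, qHahnHat q n p.1 a b N * qHahnHat q n' p.1 a b N =
      if n = n' then 1 else 0 := by
  rcases le_total n n' with hn | hn
  · exact sum_qHahnHat_mul_of_le hq0 hq1 ha hb hab hn h'
  · simp_rw [mul_comm (qHahnHat q n _ a b N), sum_qHahnHat_mul_of_le hq0 hq1 ha hb hab hn h,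
      eq_comm]

end orthonormality

/-! ### Operators on the tensor product -/

section generators

variable {E : Type*} [AddCommGroup E] [Module ℂ E]

/-- The operators on `E` by which the generators of `su_q(1,1)` act: `cartan t` is `q^{t A_0}`, and
`raise`, `lower` are `A_+`, `A_-`. -/
@[ext]
structure Generators (E : Type*) [AddCommGroup E] [Module ℂ E] where
  cartan : ℝ → Module.End ℂ E
  raise : Module.End ℂ E
  lower : Module.End ℂ E

/-- The generators acting on a tensor product through the coproduct
`Δ(A_0) = A_0 ⊗ 1 + 1 ⊗ A_0`, `Δ(A_±) = A_± ⊗ 1 + q^{A_0} ⊗ A_±`, both tensor factors being realized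
by commuting operators on the same space. -/
def Generators.coproduct (G H : Generators E) : Generators E where
  cartan t := G.cartan t * H.cartan t
  raise := G.raise + G.cartan 1 * H.raise
  lower := G.lower + G.cartan 1 * H.lower

/-- The Casimir element evaluated at `G`. -/
def Generators.casimir (q : ℝ) (G : Generators E) : Module.End ℂ E :=
  (((q ^ (1 / 2 : ℝ) - q ^ (-1 / 2 : ℝ)) ^ 2 : ℝ) : ℂ)⁻¹ •
      (((q ^ (-1 / 2 : ℝ) : ℝ) : ℂ) • G.cartan 1 + ((q ^ (1 / 2 : ℝ) : ℝ) : ℂ) • G.cartan (-1)) -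
    G.raise * G.lower * ((q : ℂ) • G.cartan (-1))

end generators

section tensorProduct

variable {d : ℕ}

theorem mem_interval {i j : ℕ} {k : Fin d} :
    k ∈ interval d i j ↔ i ≤ (k : ℕ) + 1 ∧ (k : ℕ) + 1 ≤ j := by
  simp [interval]

theorem interval_eq_empty {i j : ℕ} (h : j < i) : interval d i j = ∅ :=
  Finset.filter_eq_empty_iff.2 fun _ _ => by omega

theorem interval_val_succ (k : Fin d) : interval d (k + 1) (k + 1) = {k} := by
  ext l
  simp only [mem_interval, Finset.mem_singleton, Fin.ext_iff]
  omega

theorem interval_union_interval {i j k : ℕ} (hij : i ≤ j + 1) (hjk : j ≤ k) :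
    interval d i j ∪ interval d (j + 1) k = interval d i k := by
  ext l
  simp only [mem_interval, Finset.mem_union]
  omega

theorem disjoint_interval (i j k : ℕ) : Disjoint (interval d i j) (interval d (j + 1) k) :=
  Finset.disjoint_left.2 fun l => by
    simp only [mem_interval]
    omega

theorem qA0Set_empty (q s : ℝ) (α : Fin d → ℝ) : qA0Set q s α ∅ = 1 := by
  simp only [qA0Set, Finset.notMem_empty, if_false]
  exact PiTensorProduct.map_id

theorem qA0Set_union (q s : ℝ) (α : Fin d → ℝ) {S T : Finset (Fin d)} (h : Disjoint S T) :
    qA0Set q s α (S ∪ T) = qA0Set q s α S * qA0Set q s α T := by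
  rw [qA0Set, qA0Set, qA0Set, ← PiTensorProduct.map_mul]
  congr 1
  funext l
  by_cases hS : l ∈ S
  · simp only [Finset.mem_union, hS, Finset.disjoint_left.1 h hS, true_or, if_true, if_false]
    rfl
  · simp only [Finset.mem_union, hS, false_or, if_false]
    rfl

theorem qA0Set_interval_mul (q s : ℝ) (α : Fin d → ℝ) {i j k : ℕ} (hij : i ≤ j + 1) (hjk : j ≤ k) :
    qA0Set q s α (interval d i k) =
      qA0Set q s α (interval d i j) * qA0Set q s α (interval d (j + 1) k) := by
  rw [← interval_union_interval hij hjk, qA0Set_union q s α (disjoint_interval i j k)]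

theorem sum_interval_qA0Set_mul (q : ℝ) (α : Fin d → ℝ) (B : Fin d → Module.End ℂ (W d))
    {i j k : ℕ} (hij : i ≤ j + 1) (hjk : j ≤ k) :
    ∑ l ∈ interval d i k, qA0Set q 1 α (interval d i l) * B l =
      ∑ l ∈ interval d i j, qA0Set q 1 α (interval d i l) * B l +
        qA0Set q 1 α (interval d i j) *
          ∑ l ∈ interval d (j + 1) k, qA0Set q 1 α (interval d (j + 1) l) * B l := by
  rw [← interval_union_interval hij hjk, Finset.sum_union (disjoint_interval i j k),
    Finset.mul_sum]
  refine congrArg _ (Finset.sum_congr rfl fun l hl => ?_)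
  rw [qA0Set_interval_mul q 1 α hij (Nat.succ_le_succ_iff.1 (mem_interval.1 hl).1), mul_assoc]

/-- The generators attached to the set `[i;j]` of tensor factors. -/
def generators (q : ℝ) (α : Fin d → ℝ) (i j : ℕ) : Generators (W d) where
  cartan t := qA0Set q t α (interval d i j)
  raise := AplusSet q α i j
  lower := AminusSet q α i j

theorem casimir_generators (q : ℝ) (α : Fin d → ℝ) (i j : ℕ) :
    (generators q α i j).casimir q = Casimir q α i j := rfl

theorem generators_eq_coproduct (q : ℝ) (α : Fin d → ℝ) {i j k : ℕ} (hij : i ≤ j + 1)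
    (hjk : j ≤ k) :
    generators q α i k = (generators q α i j).coproduct (generators q α (j + 1) k) := by
  ext1
  · exact funext fun t => qA0Set_interval_mul q t α hij hjk
  · exact sum_interval_qA0Set_mul q α _ hij hjk
  · exact sum_interval_qA0Set_mul q α _ hij hjk

theorem sum_interval_self_qA0Set_mul (q : ℝ) (α : Fin d → ℝ) (B : Fin d → Module.End ℂ (W d))
    (k : Fin d) :
    ∑ l ∈ interval d (k + 1) (k + 1), qA0Set q 1 α (interval d (k + 1) l) * B l = B k := by
  rw [interval_val_succ, Finset.sum_singleton, interval_eq_empty k.val.lt_succ_self, qA0Set_empty,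
    one_mul]

theorem map_e (f : Fin d → Module.End ℂ V) (c : Fin d → ℕ → ℂ) (g : Fin d → ℕ → ℕ)
    (hf : ∀ l n, f l (eV n) = c l n • eV (g l n)) (y : Fin d → ℕ) :
    PiTensorProduct.map f (e d y) = (∏ l, c l (y l)) • e d fun l => g l (y l) := by
  simp only [e_apply, PiTensorProduct.map_tprod, hf]
  exact MultilinearMap.map_smul_univ _ _ _

theorem site_e (k : Fin d) (A : Module.End ℂ V) (c : ℕ → ℂ) (g : ℕ → ℕ)
    (hA : ∀ n, A (eV n) = c n • eV (g n)) (y : Fin d → ℕ) :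
    site k A (e d y) = c (y k) • e d (update y k (g (y k))) := by
  rw [site, map_e _ (fun l n => if l = k then c n else 1) (fun l n => if l = k then g n else n)
    (fun l n => by split_ifs <;> simp [hA]), Finset.prod_ite_eq' Finset.univ k fun l => c (y l),
    if_pos (Finset.mem_univ k)]
  congr 2
  ext l
  rw [Function.update_apply]
  split_ifs with h
  · rw [h]
  · rfl

theorem qA0Set_singleton (q s : ℝ) (α : Fin d → ℝ) (k : Fin d) :
    qA0Set q s α {k} = site k (qA0 q s (α k)) := by
  refine congrArg PiTensorProduct.map (funext fun l => ?_)
  rcases eq_or_ne l k with rfl | h <;> simp [*]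

end tensorProduct

/-! ### Families on which `su_q(1,1)` acts through one label -/

section ladder

variable {ι E : Type*} [DecidableEq ι] [AddCommGroup E] [Module ℂ E]

/-- The function `a` of multi-indices does not depend on the label at `p`. -/
def IndepAt {R : Type*} (a : (ι → ℕ) → R) (p : ι) : Prop := ∀ s v, a (update s p v) = a s

/-- The operators `G` act on the family `F` as the generators act on the basis of `V^{(a)}`, the
label at `p` being the level and the type `a` being allowed to depend on the other labels. -/
structure Ladder (q : ℝ) (G : Generators E) (p : ι) (a : (ι → ℕ) → ℝ) (F : (ι → ℕ) → E) :
    Prop where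
  weight : ∀ t s, G.cartan t (F s) = ((q ^ (t * (s p + (a s + 1) / 2)) : ℝ) : ℂ) • F s
  raise : ∀ s, G.raise (F s) = ((√(sigma q (a s) (s p + 1)) : ℝ) : ℂ) • F (update s p (s p + 1))
  lower : ∀ s, G.lower (F s) = ((√(sigma q (a s) (s p)) : ℝ) : ℂ) • F (update s p (s p - 1))

theorem ladder_e {d : ℕ} (q : ℝ) (α : Fin d → ℝ) (k : Fin d) :
    Ladder q (generators q α (k + 1) (k + 1)) k (fun _ => α k) (e d) where
  weight t s := by
    change qA0Set q t α _ _ = _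
    rw [interval_val_succ, qA0Set_singleton]
    rw [site_e k (qA0 q t (α k)) _ id fun n => eV.constr_basis .., id_eq,
      Function.update_eq_self]
  raise s := by
    rw [generators, AplusSet, sum_interval_self_qA0Set_mul]
    exact site_e k _ _ _ (fun n => eV.constr_basis ..) s
  lower s := by
    rw [generators, AminusSet, sum_interval_self_qA0Set_mul]
    exact site_e k _ _ _ (fun n => eV.constr_basis ..) s

variable {q : ℝ} {G : Generators E} {p : ι} {a : (ι → ℕ) → ℝ} {F : (ι → ℕ) → E}

theorem Ladder.raise_lower (hq0 : 0 < q) (hq1 : q < 1) (h : Ladder q G p a F) (hp : IndepAt a p)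
    (ha : ∀ s, -1 < a s) (s : ι → ℕ) :
    G.raise (G.lower (F s)) = ((sigma q (a s) (s p) : ℝ) : ℂ) • F s := by
  rw [h.lower, map_smul, h.raise, smul_smul, hp, Function.update_self, Function.update_idem,
    ← Complex.ofReal_mul]
  rcases hs : s p with _ | n
  · simp
  · rw [Nat.add_sub_cancel, Real.mul_self_sqrt (sigma_succ_pos hq0 hq1 (ha s) n).le, ← hs,
      Function.update_eq_self]

theorem gamma_eq_casimir (hq0 : 0 < q) (hq1 : q < 1) (a : ℝ) (n : ℕ) :
    ((q ^ (1 / 2 : ℝ) - q ^ (-1 / 2 : ℝ)) ^ 2)⁻¹ *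
        (q ^ (-1 / 2 : ℝ) * q ^ ((n : ℝ) + (a + 1) / 2) +
          q ^ (1 / 2 : ℝ) * q ^ (-((n : ℝ) + (a + 1) / 2))) -
      q * q ^ (-((n : ℝ) + (a + 1) / 2)) * sigma q a n = gamma q a := by
  set r := q ^ (1 / 2 : ℝ) with hr
  set c := q ^ (a / 2) with hc
  have hr0 : 0 < r := Real.rpow_pos_of_pos hq0 _
  have hc0 : 0 < c := Real.rpow_pos_of_pos hq0 _
  have hn : 0 < q ^ n := pow_pos hq0 n
  have hqr : q = r ^ 2 := by
    rw [hr, ← Real.sqrt_eq_rpow, Real.sq_sqrt hq0.le]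
  have hr_inv : q ^ (-1 / 2 : ℝ) = r⁻¹ := by rw [hr, ← Real.rpow_neg hq0.le, neg_div]
  have hc_inv : q ^ (-a / 2) = c⁻¹ := by rw [hc, ← Real.rpow_neg hq0.le, neg_div]
  have hlevel : q ^ ((n : ℝ) + (a + 1) / 2) = q ^ n * c * r := by
    rw [Real.rpow_add hq0, add_div, Real.rpow_add hq0, Real.rpow_natCast, mul_assoc]
  have hlevel_inv : q ^ (-((n : ℝ) + (a + 1) / 2)) = (q ^ n * c * r)⁻¹ := by
    rw [Real.rpow_neg hq0.le, hlevel]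
  have hσ : q ^ ((n : ℝ) + a) = q ^ n * c ^ 2 := by
    rw [Real.rpow_add hq0, Real.rpow_natCast, hc, ← Real.rpow_mul_natCast hq0.le, Nat.cast_ofNat,
      div_mul_cancel₀ _ two_ne_zero]
  have hr1 : 1 - r ^ 2 ≠ 0 := by rw [← hqr]; linarith
  have hden : r - r⁻¹ = -(1 - r ^ 2) / r := by field_simp; ring
  rw [gamma, sigma, hr_inv, hlevel, hlevel_inv, hσ, hc_inv, ← hr, ← hc, hden]
  clear_value r c
  generalize q ^ n = Q at hn ⊢
  rw [hqr]
  generalize 1 - r ^ 2 = D at hr1 ⊢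
  field_simp
  ring

theorem Ladder.casimir (hq0 : 0 < q) (hq1 : q < 1) (h : Ladder q G p a F) (hp : IndepAt a p)
    (ha : ∀ s, -1 < a s) (s : ι → ℕ) :
    G.casimir q (F s) = ((gamma q (a s) : ℝ) : ℂ) • F s := by
  simp only [Generators.casimir, LinearMap.sub_apply, LinearMap.smul_apply, LinearMap.add_apply,
    Module.End.mul_apply, h.weight, map_smul, h.raise_lower hq0 hq1 hp ha, smul_smul, ← add_smul,
    ← sub_smul, one_mul, neg_one_mul]
  rw [← gamma_eq_casimir hq0 hq1 (a s) (s p)]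
  push_cast
  rw [mul_add, mul_assoc]

end ladder

/-! ### Coupling two labels -/

section update₂

variable {ι : Type*} [DecidableEq ι] {p p' : ι}

/-- The multi-index `s` with the labels at `p` and `p'` set to `x` and `z`. -/
def update₂ (s : ι → ℕ) (p p' : ι) (x z : ℕ) : ι → ℕ := update (update s p x) p' z

theorem update₂_left (hpp : p ≠ p') (s : ι → ℕ) (x z : ℕ) : update₂ s p p' x z p = x := by
  rw [update₂, Function.update_of_ne hpp, Function.update_self]

theorem update₂_right (s : ι → ℕ) (x z : ℕ) : update₂ s p p' x z p' = z :=
  Function.update_self ..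

theorem update₂_of_ne {t : ι} (ht : t ≠ p) (ht' : t ≠ p') (s : ι → ℕ) (x z : ℕ) :
    update₂ s p p' x z t = s t := by
  rw [update₂, Function.update_of_ne ht', Function.update_of_ne ht]

theorem update_update₂_left (hpp : p ≠ p') (s : ι → ℕ) (x z v : ℕ) :
    update (update₂ s p p' x z) p v = update₂ s p p' v z := by
  rw [update₂, Function.update_comm hpp.symm, Function.update_idem, update₂]

theorem update_update₂_right (s : ι → ℕ) (x z v : ℕ) :
    update (update₂ s p p' x z) p' v = update₂ s p p' x v := by
  rw [update₂, Function.update_idem, update₂]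

theorem update₂_update_right (hpp : p ≠ p') (s : ι → ℕ) (x z v : ℕ) :
    update₂ (update s p' v) p p' x z = update₂ s p p' x z := by
  rw [update₂, Function.update_comm hpp.symm, Function.update_idem, update₂]

theorem update₂_update_of_ne {t : ι} (ht : t ≠ p) (ht' : t ≠ p') (s : ι → ℕ) (x z v : ℕ) :
    update₂ (update s t v) p p' x z = update (update₂ s p p' x z) t v := by
  rw [update₂, Function.update_comm ht, Function.update_comm ht', update₂]

theorem eq_update₂_iff (hpp : p ≠ p') {s s' : ι → ℕ} {x z : ℕ} :
    s' = update₂ s p p' x z ↔ s' p = x ∧ s' p' = z ∧ ∀ t, t ≠ p → t ≠ p' → s' t = s t := by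
  rw [update₂, Function.eq_update_iff]
  constructor
  · rintro ⟨hz, h⟩
    exact ⟨by rw [h p hpp, Function.update_self], hz,
      fun t ht ht' => by rw [h t ht', Function.update_of_ne ht]⟩
  · rintro ⟨hx, hz, h⟩
    refine ⟨hz, fun t ht' => ?_⟩
    rcases eq_or_ne t p with rfl | ht
    · rw [hx, Function.update_self]
    · rw [h t ht ht', Function.update_of_ne ht]

theorem update₂_eq_update₂_iff (hpp : p ≠ p') {s s' : ι → ℕ} {x z x' z' : ℕ} :
    update₂ s p p' x z = update₂ s' p p' x' z' ↔
      x = x' ∧ z = z' ∧ ∀ t, t ≠ p → t ≠ p' → s t = s' t := by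
  rw [eq_update₂_iff hpp, update₂_left hpp, update₂_right]
  refine and_congr_right fun _ => and_congr_right fun _ => forall₃_congr fun t ht ht' => ?_
  rw [update₂_of_ne ht ht']

theorem IndepAt.apply_update₂ {R : Type*} {a : (ι → ℕ) → R} (h : IndepAt a p) (h' : IndepAt a p')
    (s : ι → ℕ) (x z : ℕ) : a (update₂ s p p' x z) = a s := by
  rw [update₂, h', h]

end update₂

section couple

variable {ι E : Type*} [DecidableEq ι] [AddCommGroup E] [Module ℂ E]

/-- The Clebsch–Gordan coupling of the labels at `p` and `p'`: the new label at `p` is the degree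
of the `q`-Hahn function, the new label at `p'` is the level in the coupled representation. -/
def couple (q : ℝ) (p p' : ι) (a b : (ι → ℕ) → ℝ) (F : (ι → ℕ) → E) (s : ι → ℕ) : E :=
  ∑ x ∈ antidiagonal (s p + s p'),
    ((qHahnHat q (s p) x.1 (a s) (b s) (s p + s p' : ℕ) : ℝ) : ℂ) • F (update₂ s p p' x.1 x.2)

/-- The type of the representation in which `couple` puts the label at `p'`. -/
def coupledType (p : ι) (a b : (ι → ℕ) → ℝ) (s : ι → ℕ) : ℝ := a s + b s + 1 + 2 * s p

/-- The conditions on the types `a` and `b` under which the labels at `p` and `p'` can be coupled.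
The `q`-Hahn normalization contains the factor `(1 - q^(a + b + 1)) / (q^(a + b + 1); q)_n`, which
is a junk value when `a + b + 1 = 0`. -/
structure Couplable (p p' : ι) (a b : (ι → ℕ) → ℝ) : Prop where
  ne : p ≠ p'
  left : IndepAt a p
  left' : IndepAt a p'
  right : IndepAt b p
  right' : IndepAt b p'
  neg_one_lt_left : ∀ s, -1 < a s
  neg_one_lt_right : ∀ s, -1 < b s
  add_ne_zero : ∀ s, a s + b s + 1 ≠ 0

variable {q : ℝ} {p p' : ι} {a b : (ι → ℕ) → ℝ} {F : (ι → ℕ) → E}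

theorem Couplable.neg_one_lt_coupledType (h : Couplable p p' a b) (s : ι → ℕ) :
    -1 < coupledType p a b s := by
  have : (0 : ℝ) ≤ s p := Nat.cast_nonneg _
  rw [coupledType]
  linarith [h.neg_one_lt_left s, h.neg_one_lt_right s]

theorem Couplable.indepAt_coupledType (h : Couplable p p' a b) :
    IndepAt (coupledType p a b) p' := fun s v => by
  rw [coupledType, h.left', h.right', Function.update_of_ne h.ne, coupledType]

theorem map_couple {T : Module.End ℂ E} {c : ℂ} {s s' : ι → ℕ} (hp : s' p = s p)
    (hp' : s' p' = s p') (ha : a s' = a s) (hb : b s' = b s)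
    (h : ∀ x z, x + z = s p + s p' →
      T (F (update₂ s p p' x z)) = c • F (update₂ s' p p' x z)) :
    T (couple q p p' a b F s) = c • couple q p p' a b F s' := by
  rw [couple, couple, map_sum, Finset.smul_sum, hp, hp', ha, hb]
  refine Finset.sum_congr rfl fun x hx => ?_
  rw [map_smul, h _ _ (mem_antidiagonal.1 hx), smul_comm]

theorem Ladder.couple_of_ne {G : Generators E} {t : ι} {c : (ι → ℕ) → ℝ} (h : Ladder q G t c F)
    (ht : t ≠ p) (ht' : t ≠ p') (hc : IndepAt c p) (hc' : IndepAt c p') (ha : IndepAt a t)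
    (hb : IndepAt b t) : Ladder q G t c (couple q p p' a b F) where
  weight u s := map_couple rfl rfl rfl rfl fun x z _ => by
    rw [h.weight, hc.apply_update₂ hc', update₂_of_ne ht ht']
  raise s := map_couple (Function.update_of_ne ht.symm _ _) (Function.update_of_ne ht'.symm _ _)
    (ha s _) (hb s _) fun x z _ => by
      rw [h.raise, hc.apply_update₂ hc', update₂_of_ne ht ht', update₂_update_of_ne ht ht']
  lower s := map_couple (Function.update_of_ne ht.symm _ _) (Function.update_of_ne ht'.symm _ _)
    (ha s _) (hb s _) fun x z _ => by
      rw [h.lower, hc.apply_update₂ hc', update₂_of_ne ht ht', update₂_update_of_ne ht ht']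

theorem sum_qHahnHat_smul_raise (hq0 : 0 < q) (hq1 : q < 1) {a b : ℝ} (ha : -1 < a) (hb : -1 < b)
    (hab : a + b + 1 ≠ 0) (Φ : ℕ → ℕ → E) (n r : ℕ) :
    ∑ x ∈ antidiagonal (n + r), ((qHahnHat q n x.1 a b (n + r : ℕ) : ℝ) : ℂ) •
        (((√(sigma q a (x.1 + 1)) : ℝ) : ℂ) • Φ (x.1 + 1) x.2 +
          ((q ^ ((x.1 : ℝ) + (a + 1) / 2) * √(sigma q b (x.2 + 1)) : ℝ) : ℂ) • Φ x.1 (x.2 + 1)) =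
      ((√(sigma q (a + b + 1 + 2 * n) (r + 1)) : ℝ) : ℂ) •
        ∑ x ∈ antidiagonal (n + (r + 1)), ((qHahnHat q n x.1 a b (n + (r + 1) : ℕ) : ℝ) : ℂ) •
          Φ x.1 x.2 := by
  have hterm : ∀ x ∈ antidiagonal (n + r + 1),
      ((√(sigma q (a + b + 1 + 2 * n) (r + 1)) : ℝ) : ℂ) •
        ((qHahnHat q n x.1 a b (n + r + 1 : ℕ) : ℝ) : ℂ) • Φ x.1 x.2 =
      ((√(sigma q a x.1) * qHahnHat q n ((x.1 : ℤ) - 1) a b ((n + r : ℕ) : ℤ) : ℝ) : ℂ) •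
        Φ x.1 x.2 +
      ((q ^ ((x.1 : ℝ) + (a + 1) / 2) * √(sigma q b x.2) *
        qHahnHat q n x.1 a b ((n + r : ℕ) : ℤ) : ℝ) : ℂ) • Φ x.1 x.2 := fun x hx => by
    rw [smul_smul, ← Complex.ofReal_mul,
      ← qHahnHat_raise hq0 hq1 ha hb hab rfl (mem_antidiagonal.1 hx), Complex.ofReal_add, add_smul]
  rw [← add_assoc n r 1, Finset.smul_sum, Finset.sum_congr rfl hterm, Finset.sum_add_distrib,
    Finset.Nat.sum_antidiagonal_succ, Finset.Nat.sum_antidiagonal_succ']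
  simp only [sigma_zero, Real.sqrt_zero, zero_mul, mul_zero, zero_add, Complex.ofReal_zero,
    zero_smul, Nat.cast_succ, add_sub_cancel_right]
  rw [← Finset.sum_add_distrib]
  refine Finset.sum_congr rfl fun x _ => ?_
  rw [smul_add, smul_smul, smul_smul, ← Complex.ofReal_mul, ← Complex.ofReal_mul, mul_comm,
    mul_comm (_ * _)]

theorem sum_qHahnHat_smul_lower (hq0 : 0 < q) (hq1 : q < 1) {a b : ℝ} (ha : -1 < a) (hb : -1 < b)
    (hab : a + b + 1 ≠ 0) (Φ : ℕ → ℕ → E) (n r : ℕ) :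
    ∑ x ∈ antidiagonal (n + r), ((qHahnHat q n x.1 a b (n + r : ℕ) : ℝ) : ℂ) •
        (((√(sigma q a x.1) : ℝ) : ℂ) • Φ (x.1 - 1) x.2 +
          ((q ^ ((x.1 : ℝ) + (a + 1) / 2) * √(sigma q b x.2) : ℝ) : ℂ) • Φ x.1 (x.2 - 1)) =
      ((√(sigma q (a + b + 1 + 2 * n) r) : ℝ) : ℂ) •
        ∑ x ∈ antidiagonal (n + (r - 1)), ((qHahnHat q n x.1 a b (n + (r - 1) : ℕ) : ℝ) : ℂ) •
          Φ x.1 x.2 := by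
  rcases hN : n + r with _ | N
  · obtain rfl : r = 0 := by omega
    simp
  have hterm : ∀ x ∈ antidiagonal N,
      ((qHahnHat q n ((x.1 + 1 : ℕ) : ℤ) a b ((N + 1 : ℕ) : ℤ) : ℝ) : ℂ) •
        ((√(sigma q a (x.1 + 1)) : ℝ) : ℂ) • Φ x.1 x.2 +
      ((qHahnHat q n x.1 a b ((N + 1 : ℕ) : ℤ) : ℝ) : ℂ) •
        ((q ^ ((x.1 : ℝ) + (a + 1) / 2) * √(sigma q b (x.2 + 1)) : ℝ) : ℂ) • Φ x.1 x.2 =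
      ((√(sigma q (a + b + 1 + 2 * n) r) : ℝ) : ℂ) •
        ((qHahnHat q n x.1 a b (N : ℕ) : ℝ) : ℂ) • Φ x.1 x.2 := fun x hx => by
    simp only [smul_smul, ← add_smul, ← Complex.ofReal_mul, ← Complex.ofReal_add]
    rw [← qHahnHat_lower hq0 hq1 ha hb hab hN (mem_antidiagonal.1 hx), mul_comm,
      mul_comm (qHahnHat _ _ x.1 _ _ _)]
  simp only [smul_add, Finset.sum_add_distrib]
  rw [Finset.Nat.sum_antidiagonal_succ, Finset.Nat.sum_antidiagonal_succ']
  simp only [sigma_zero, Real.sqrt_zero, mul_zero, zero_add, Complex.ofReal_zero, zero_smul,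
    smul_zero, Nat.add_sub_cancel]
  rw [← Finset.sum_add_distrib, Finset.sum_congr rfl hterm, Finset.smul_sum]
  rcases r with _ | r
  · simp
  · rw [Nat.add_sub_cancel, show n + r = N by omega]

theorem Couplable.coproduct_weight (h : Couplable p p' a b) {G H : Generators E} (hq0 : 0 < q)
    (hG : Ladder q G p a F) (hH : Ladder q H p' b F) (t : ℝ) (s : ι → ℕ) {x z : ℕ}
    (hxz : x + z = s p + s p') :
    (G.coproduct H).cartan t (F (update₂ s p p' x z)) =
      ((q ^ (t * (s p' + (coupledType p a b s + 1) / 2)) : ℝ) : ℂ) • F (update₂ s p p' x z) := by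
  have hxz : (x : ℝ) + z = s p + s p' := mod_cast hxz
  rw [Generators.coproduct, Module.End.mul_apply, hH.weight, map_smul, hG.weight,
    h.left.apply_update₂ h.left', h.right.apply_update₂ h.right', update₂_left h.ne,
    update₂_right, smul_smul, ← Complex.ofReal_mul, ← Real.rpow_add hq0, coupledType]
  congr 4
  linear_combination t * hxz

theorem Couplable.ladder_couple (h : Couplable p p' a b) {G H : Generators E} (hq0 : 0 < q)
    (hq1 : q < 1) (hG : Ladder q G p a F) (hH : Ladder q H p' b F) :
    Ladder q (G.coproduct H) p' (coupledType p a b) (couple q p p' a b F) where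
  weight t s := map_couple rfl rfl rfl rfl fun _ _ => h.coproduct_weight hq0 hG hH t s
  raise s := by
    rw [couple, couple, Function.update_self, Function.update_of_ne h.ne, h.left', h.right',
      map_sum]
    simp only [update₂_update_right h.ne]
    refine (Finset.sum_congr rfl fun x _ => ?_).trans (sum_qHahnHat_smul_raise hq0 hq1
      (h.neg_one_lt_left s) (h.neg_one_lt_right s) (h.add_ne_zero s)
      (fun x z => F (update₂ s p p' x z)) (s p) (s p'))
    rw [map_smul, Generators.coproduct, LinearMap.add_apply, Module.End.mul_apply, hG.raise,
      hH.raise, map_smul, update_update₂_left h.ne, update_update₂_right, hG.weight,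
      h.left.apply_update₂ h.left', h.left.apply_update₂ h.left', h.right.apply_update₂ h.right',
      update₂_left h.ne, update₂_left h.ne, update₂_right, smul_smul _ _ (F _),
      ← Complex.ofReal_mul, one_mul, mul_comm (√_)]
  lower s := by
    rw [couple, couple, Function.update_self, Function.update_of_ne h.ne, h.left', h.right',
      map_sum]
    simp only [update₂_update_right h.ne]
    refine (Finset.sum_congr rfl fun x _ => ?_).trans (sum_qHahnHat_smul_lower hq0 hq1
      (h.neg_one_lt_left s) (h.neg_one_lt_right s) (h.add_ne_zero s)
      (fun x z => F (update₂ s p p' x z)) (s p) (s p'))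
    rw [map_smul, Generators.coproduct, LinearMap.add_apply, Module.End.mul_apply, hG.lower,
      hH.lower, map_smul, update_update₂_left h.ne, update_update₂_right, hG.weight,
      h.left.apply_update₂ h.left', h.left.apply_update₂ h.left', h.right.apply_update₂ h.right',
      update₂_left h.ne, update₂_left h.ne, update₂_right, smul_smul _ _ (F _),
      ← Complex.ofReal_mul, one_mul, mul_comm (√_)]

end couple

section innerProduct

variable {d : ℕ}

theorem ip_add_left (v v' w : W d) : ip (v + v') w = ip v w + ip v' w := by
  simp only [ip, map_add]
  exact Finsupp.sum_add_index' (by simp) fun _ _ _ => by rw [map_add, add_mul]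

theorem ip_smul_left (c : ℂ) (v w : W d) : ip (c • v) w = (starRingEnd ℂ) c * ip v w := by
  simp only [ip, map_smul]
  rw [Finsupp.sum_smul_index' (by simp), Finsupp.mul_sum]
  exact Finsupp.sum_congr fun _ _ => by rw [smul_eq_mul, map_mul, mul_assoc]

theorem ip_add_right (v w w' : W d) : ip v (w + w') = ip v w + ip v w' := by
  simp only [ip, map_add, Finsupp.add_apply, mul_add, Finsupp.sum_add]

theorem ip_smul_right (c : ℂ) (v w : W d) : ip v (c • w) = c * ip v w := by
  simp only [ip, map_smul, Finsupp.smul_apply, smul_eq_mul, mul_left_comm _ c, Finsupp.mul_sum]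

/-- The inner product `ip` as a sesquilinear map. -/
def ipₛₗ (d : ℕ) : W d →ₗ⋆[ℂ] W d →ₗ[ℂ] ℂ :=
  LinearMap.mk₂'ₛₗ (starRingEnd ℂ) (RingHom.id ℂ) ip ip_add_left ip_smul_left ip_add_right
    ip_smul_right

theorem ip_sum_left {κ : Type*} (S : Finset κ) (c : κ → ℂ) (v : κ → W d) (w : W d) :
    ip (∑ i ∈ S, c i • v i) w = ∑ i ∈ S, (starRingEnd ℂ) (c i) * ip (v i) w := by
  change ipₛₗ d _ w = _
  simp only [map_sum, LinearMap.sum_apply, map_smulₛₗ, LinearMap.smul_apply, smul_eq_mul]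
  rfl

theorem ip_sum_right {κ : Type*} (S : Finset κ) (c : κ → ℂ) (v : W d) (w : κ → W d) :
    ip v (∑ i ∈ S, c i • w i) = ∑ i ∈ S, c i * ip v (w i) := by
  change ipₛₗ d v _ = _
  simp only [map_sum, map_smul, smul_eq_mul]
  rfl

theorem ip_e_left (y : Fin d → ℕ) (w : W d) : ip (e d y) w = (e d).repr w y := by
  simp [ip]

/-- The family `F` is orthonormal for the inner product `ip`. -/
def IsOrthonormal (F : (Fin d → ℕ) → W d) : Prop :=
  ∀ s s', ip (F s) (F s') = if s = s' then 1 else 0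

theorem isOrthonormal_e : IsOrthonormal (e d) := fun y y' => by
  rw [ip_e_left, Module.Basis.repr_self, Finsupp.single_apply]
  simp only [eq_comm]

variable {q : ℝ} {p p' : Fin d} {a b : (Fin d → ℕ) → ℝ} {F : (Fin d → ℕ) → W d}

theorem IsOrthonormal.ip_couple (h : IsOrthonormal F) (s s' : Fin d → ℕ) :
    ip (couple q p p' a b F s) (couple q p p' a b F s') =
      ((∑ x ∈ antidiagonal (s p + s p'), ∑ x' ∈ antidiagonal (s' p + s' p'),
        qHahnHat q (s p) x.1 (a s) (b s) (s p + s p' : ℕ) *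
          (qHahnHat q (s' p) x'.1 (a s') (b s') (s' p + s' p' : ℕ) *
            if update₂ s p p' x.1 x.2 = update₂ s' p p' x'.1 x'.2 then 1 else 0) : ℝ) : ℂ) := by
  rw [couple, ip_sum_left, Complex.ofReal_sum]
  refine Finset.sum_congr rfl fun x _ => ?_
  rw [couple, ip_sum_right, Complex.conj_ofReal, Complex.ofReal_sum, Finset.mul_sum]
  refine Finset.sum_congr rfl fun x' _ => ?_
  rw [h, ← Complex.ofReal_one, ← Complex.ofReal_zero, ← apply_ite, ← Complex.ofReal_mul,
    ← Complex.ofReal_mul]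

theorem Couplable.isOrthonormal_couple (h : Couplable p p' a b) (hq0 : 0 < q) (hq1 : q < 1)
    (hF : IsOrthonormal F) : IsOrthonormal (couple q p p' a b F) := by
  intro s s'
  simp only [hF.ip_couple, update₂_eq_update₂_iff h.ne, ← and_assoc, ← Prod.ext_iff]
  by_cases hs : s p + s p' = s' p + s' p' ∧ ∀ t, t ≠ p → t ≠ p' → s t = s' t
  · obtain ⟨hN, hoff⟩ := hs
    have hs : s = update₂ s' p p' (s p) (s p') := (eq_update₂_iff h.ne).2 ⟨rfl, rfl, hoff⟩
    have ha : a s = a s' := by rw [hs, h.left.apply_update₂ h.left']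
    have hb : b s = b s' := by rw [hs, h.right.apply_update₂ h.right']
    have hiff : s = s' ↔ s p = s' p :=
      ⟨fun hss => by rw [hss], fun hp => funext fun t => by
        by_cases ht : t = p
        · rw [ht, hp]
        · by_cases ht' : t = p'
          · rw [ht']; omega
          · exact hoff t ht ht'⟩
    have hsum := sum_qHahnHat_mul hq0 hq1 (h.neg_one_lt_left s') (h.neg_one_lt_right s')
      (h.add_ne_zero s') (n := s p) (n' := s' p) (hN ▸ Nat.le_add_right ..) (Nat.le_add_right ..)
    simp only [and_iff_left hoff, mul_ite, mul_one, mul_zero, Finset.sum_ite_eq, hN, ha, hb]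
    rw [Finset.sum_congr rfl fun x hx => if_pos hx, hsum]
    rw [apply_ite Complex.ofReal, Complex.ofReal_one, Complex.ofReal_zero]
    simp only [hiff]
  · rw [if_neg (by rintro rfl; exact hs ⟨rfl, fun _ _ _ => rfl⟩), Complex.ofReal_eq_zero]
    refine Finset.sum_eq_zero fun x hx => Finset.sum_eq_zero fun x' hx' => ?_
    rw [mem_antidiagonal] at hx hx'
    rw [if_neg, mul_zero, mul_zero]
    rintro ⟨rfl, hoff⟩
    exact hs ⟨hx.symm.trans hx', hoff⟩

theorem repr_couple (q : ℝ) (p p' : Fin d) (a b : (Fin d → ℕ) → ℝ) (F : (Fin d → ℕ) → W d)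
    (s y : Fin d → ℕ) :
    (e d).repr (couple q p p' a b F s) y = ∑ x ∈ antidiagonal (s p + s p'),
      ((qHahnHat q (s p) x.1 (a s) (b s) (s p + s p' : ℕ) : ℝ) : ℂ) *
        (e d).repr (F (update₂ s p p' x.1 x.2)) y := by
  simp only [couple, map_sum, Finsupp.finsetSum_apply, map_smul, Finsupp.smul_apply, smul_eq_mul]

end innerProduct

section entry

variable {R : Type*} {d : ℕ}

theorem entry_val_succ [Zero R] (x : Fin d → R) (l : Fin d) : entry x (l + 1) = x l := by
  rw [entry, dif_pos ⟨by omega, by omega⟩]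
  rfl

theorem entry_of_lt [Zero R] (x : Fin d → R) {k : ℕ} (h : d < k) : entry x k = 0 :=
  dif_neg (by omega)

theorem ext_entry [Zero R] {x y : Fin d → R} (h : ∀ k, 1 ≤ k → k ≤ d → entry x k = entry y k) :
    x = y := by
  ext l
  rw [← entry_val_succ x, ← entry_val_succ y, h _ (by omega) (by omega)]

theorem entry_update_of_ne [Zero R] (x : Fin d → R) (p : Fin d) (v : R) {k : ℕ}
    (h : k ≠ p + 1) : entry (update x p v) k = entry x k := by
  unfold entry
  split_ifs
  · exact Function.update_of_ne (by simp only [ne_eq, Fin.ext_iff]; omega) _ _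
  · rfl

theorem psum_of_lt [AddCommMonoid R] (x : Fin d → R) {i j : ℕ} (h : j < i) : psum x i j = 0 := by
  rw [psum, Finset.Icc_eq_empty (by omega), Finset.sum_empty]

theorem psum_succ [AddCommMonoid R] (x : Fin d → R) {i j : ℕ} (h : i ≤ j + 1) :
    psum x i (j + 1) = psum x i j + entry x (j + 1) :=
  Finset.sum_Icc_succ_top h _

theorem psum_self [AddCommMonoid R] (x : Fin d → R) (i : ℕ) : psum x i i = entry x i := by
  rw [psum, Finset.Icc_self, Finset.sum_singleton]

theorem psum_eq_entry_add [AddCommMonoid R] (x : Fin d → R) {i j : ℕ} (h : i ≤ j) :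
    psum x i j = entry x i + psum x (i + 1) j := by
  rw [psum, psum, ← Finset.insert_Icc_add_one_left_eq_Icc h, Finset.sum_insert (by simp)]

theorem psum_update [AddCommMonoid R] (x : Fin d → R) (p : Fin d) (v : R) {i j : ℕ}
    (h : (p : ℕ) + 1 < i ∨ j < p + 1) : psum (update x p v) i j = psum x i j := by
  refine Finset.sum_congr rfl fun k hk => entry_update_of_ne _ _ _ ?_
  rw [Finset.mem_Icc] at hk
  omega

theorem psum_one_eq_sum [AddCommMonoid R] (x : Fin d → R) : psum x 1 d = ∑ l, x l := by
  rw [psum, ← Finset.Ico_add_one_right_eq_Icc, Finset.sum_Ico_eq_sum_range, Finset.sum_range]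
  refine Finset.sum_congr rfl fun l _ => ?_
  rw [add_comm 1 (l : ℕ), ← entry_val_succ x l]

theorem neg_lt_psum {x : Fin d → ℝ} (hx : ∀ k, -1 < x k) {i j : ℕ} (hi : 1 ≤ i) (hij : i ≤ j)
    (hj : j ≤ d) : -((j : ℝ) + 1 - i) < psum x i j := by
  induction j, hij using Nat.le_induction with
  | base =>
    have h := hx ⟨i - 1, by omega⟩
    rw [← entry_val_succ x, Nat.sub_add_cancel hi] at h
    rw [psum_self]
    linarith
  | succ j hij ih =>
    have h := hx ⟨j, hj⟩
    rw [← entry_val_succ x] at h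
    rw [psum_succ x (by omega)]
    push_cast
    linarith [ih (by omega)]

theorem entry_update₂_of_ne (s : Fin d → ℕ) (p p' : Fin d) (x z : ℕ) {k : ℕ} (h : k ≠ p + 1)
    (h' : k ≠ p' + 1) : entry (update₂ s p p' x z) k = entry s k := by
  rw [update₂, entry_update_of_ne _ _ _ h', entry_update_of_ne _ _ _ h]

theorem entry_update₂_left {p p' : Fin d} (hpp : p ≠ p') (s : Fin d → ℕ) (x z : ℕ) :
    entry (update₂ s p p' x z) (p + 1) = x := by
  rw [entry_val_succ, update₂_left hpp]

theorem entry_update₂_right (s : Fin d → ℕ) (p p' : Fin d) (x z : ℕ) :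
    entry (update₂ s p p' x z) (p' + 1) = z := by
  rw [entry_val_succ, update₂_right]

theorem psum_update₂ (s : Fin d → ℕ) (p p' : Fin d) (x z : ℕ) {i j : ℕ}
    (h : (p : ℕ) + 1 < i ∨ j < p + 1) (h' : (p' : ℕ) + 1 < i ∨ j < p' + 1) :
    psum (update₂ s p p' x z) i j = psum s i j := by
  rw [update₂, psum_update _ _ _ h', psum_update _ _ _ h]

end entry

/-! ### Coupling the factors `2, 3, …` successively -/

section stage

variable {d : ℕ} {q : ℝ} {α : Fin d → ℝ}

/-- The types `α` for which the coupled basis is defined: the `V^{(α_k)}` exist, and the lowest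
type occurring in each of the coupled representations is nonzero (see `Couplable`). -/
structure Admissible (α : Fin d → ℝ) : Prop where
  neg_one_lt : ∀ k, -1 < α k
  coupled_ne_zero : ∀ k : ℕ, 3 ≤ k → k ≤ d → psum α 2 k + k - 2 ≠ 0
  full_ne_zero : psum α 1 d + d - 1 ≠ 0

/-- The type of the representation obtained by coupling the factors `2, …, k + 2`. -/
def stageType (α : Fin d → ℝ) (k : ℕ) (s : Fin d → ℕ) : ℝ :=
  2 * ((psum s 2 (k + 1) : ℕ) : ℝ) + psum α 2 (k + 2) + k

/-- The basis obtained from the direct-product basis by coupling the factors `2, …, k + 2`. -/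
def stage (q : ℝ) (α : Fin d → ℝ) : ℕ → (Fin d → ℕ) → W d
  | 0 => e d
  | k + 1 => if h : k + 2 < d then
      couple q ⟨k + 1, by omega⟩ ⟨k + 2, h⟩ (stageType α k) (fun _ => α ⟨k + 2, h⟩) (stage q α k)
    else stage q α k

theorem stage_succ {k : ℕ} (h : k + 2 < d) : stage q α (k + 1) =
    couple q ⟨k + 1, by omega⟩ ⟨k + 2, h⟩ (stageType α k) (fun _ => α ⟨k + 2, h⟩)
      (stage q α k) := by
  rw [stage, dif_pos h]

theorem indepAt_const {ι R : Type*} [DecidableEq ι] (c : R) (p : ι) :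
    IndepAt (fun _ : ι → ℕ => c) p := fun _ _ => rfl

theorem indepAt_stageType (α : Fin d → ℝ) {k : ℕ} {p : Fin d} (h : (p : ℕ) = 0 ∨ k + 1 ≤ p) :
    IndepAt (stageType α k) p := fun s v => by
  rw [stageType, psum_update _ _ _ (by omega), stageType]

theorem stageType_zero (hd : 1 < d) : stageType α 0 = fun _ => α ⟨1, hd⟩ := by
  funext s
  rw [stageType, psum_of_lt s (by omega), psum_self, ← entry_val_succ α ⟨1, hd⟩]
  simp

theorem stageType_succ {k : ℕ} (h : k + 2 < d) :
    stageType α (k + 1) =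
      coupledType ⟨k + 1, by omega⟩ (stageType α k) (fun _ => α ⟨k + 2, h⟩) := by
  funext s
  rw [stageType, coupledType, stageType, psum_succ s (by omega), psum_succ α (by omega),
    ← entry_val_succ s, ← entry_val_succ α]
  push_cast
  ring

theorem neg_one_lt_stageType (hα : ∀ k, -1 < α k) {k : ℕ} (hk : k + 2 ≤ d) (s : Fin d → ℕ) :
    -1 < stageType α k s := by
  have hpsum := neg_lt_psum hα (i := 2) (j := k + 2) (by omega) (by omega) hk
  have : (0 : ℝ) ≤ (psum s 2 (k + 1) : ℕ) := Nat.cast_nonneg _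
  push_cast at hpsum
  rw [stageType]
  linarith

theorem two_mul_natCast_add_ne_zero {x : ℝ} (hx : -2 < x) (hx0 : x ≠ 0) (n : ℕ) :
    2 * (n : ℝ) + x ≠ 0 := by
  rcases n.eq_zero_or_pos with rfl | hn
  · simpa using hx0
  · have : (1 : ℝ) ≤ n := mod_cast hn
    exact (by linarith : 0 < 2 * (n : ℝ) + x).ne'

theorem Admissible.couplable_stage (hα : Admissible α) {k : ℕ} (hk : k + 2 < d) :
    Couplable ⟨k + 1, by omega⟩ ⟨k + 2, hk⟩ (stageType α k) (fun _ => α ⟨k + 2, hk⟩) where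
  ne := by simp [Fin.ext_iff]
  left := indepAt_stageType α (Or.inr le_rfl)
  left' := indepAt_stageType α (Or.inr (Nat.le_succ _))
  right := indepAt_const _ _
  right' := indepAt_const _ _
  neg_one_lt_left := neg_one_lt_stageType hα.neg_one_lt hk.le
  neg_one_lt_right _ := hα.neg_one_lt _
  add_ne_zero s := by
    have hne := hα.coupled_ne_zero (k + 3) (by omega) hk
    have hlt := neg_lt_psum hα.neg_one_lt (i := 2) (j := k + 3) (by omega) (by omega) hk
    rw [psum_succ α (by omega), entry_val_succ α ⟨k + 2, hk⟩] at hne hlt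
    push_cast at hne hlt
    convert two_mul_natCast_add_ne_zero (by linarith) hne (psum s 2 (k + 1)) using 1
    rw [stageType]
    ring

theorem ladder_stage_of_uncoupled {k : ℕ} (hk : k + 1 < d) {l : Fin d}
    (hl : (l : ℕ) = 0 ∨ k + 2 ≤ l) :
    Ladder q (generators q α (l + 1) (l + 1)) l (fun _ => α l) (stage q α k) := by
  induction k with
  | zero => exact ladder_e q α l
  | succ k ih =>
    rw [stage_succ hk]
    refine (ih (by omega) (by omega)).couple_of_ne ?_ ?_ (indepAt_const _ _) (indepAt_const _ _)
      (indepAt_stageType α (by omega)) (indepAt_const _ _)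
    all_goals simp only [ne_eq, Fin.ext_iff]; omega

theorem ladder_stage (hq0 : 0 < q) (hq1 : q < 1) (hα : Admissible α) {k : ℕ} (hk : k + 1 < d) :
    Ladder q (generators q α 2 (k + 2)) ⟨k + 1, hk⟩ (stageType α k) (stage q α k) := by
  induction k with
  | zero =>
    rw [stageType_zero hk]
    exact ladder_e q α ⟨1, hk⟩
  | succ k ih =>
    rw [stage_succ hk, stageType_succ hk,
      generators_eq_coproduct q α (j := k + 2) (by omega) (by omega)]
    exact (hα.couplable_stage hk).ladder_couple hq0 hq1 (ih (by omega))
      (ladder_stage_of_uncoupled (by omega) (l := ⟨k + 2, hk⟩) (Or.inr le_rfl))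

theorem casimir_stage (hq0 : 0 < q) (hq1 : q < 1) (hα : Admissible α) {j k : ℕ} (hjk : j ≤ k)
    (hk : k + 1 < d) (s : Fin d → ℕ) :
    Casimir q α 2 (j + 2) (stage q α k s) =
      ((gamma q (stageType α j s) : ℝ) : ℂ) • stage q α k s := by
  induction k, hjk using Nat.le_induction generalizing s with
  | base =>
    exact (ladder_stage hq0 hq1 hα hk).casimir hq0 hq1 (indepAt_stageType α (Or.inr le_rfl))
      (neg_one_lt_stageType hα.neg_one_lt hk) s
  | succ k hjk ih =>
    rw [stage_succ hk]
    refine map_couple rfl rfl rfl rfl fun x z _ => ?_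
    rw [ih (by omega), (indepAt_stageType α _).apply_update₂ (indepAt_stageType α _)] <;>
      exact Or.inr (by simp only; omega)

theorem isOrthonormal_stage (hq0 : 0 < q) (hq1 : q < 1) (hα : Admissible α) {k : ℕ}
    (hk : k + 1 < d) : IsOrthonormal (stage q α k) := by
  induction k with
  | zero => exact isOrthonormal_e
  | succ k ih =>
    rw [stage_succ hk]
    exact (hα.couplable_stage hk).isOrthonormal_couple hq0 hq1 (ih (by omega))

end stage

/-! ### The coefficients of the coupled vectors -/

section coefficients

theorem sum_qHahnHat_mul_ite (q a b : ℝ) (n N M M' X Z : ℕ) (c : ℂ) :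
    ∑ x ∈ antidiagonal N, ((qHahnHat q n x.1 a b N : ℝ) : ℂ) *
        (if M + x.1 = X ∧ M' + x.2 = Z then c else 0) =
      if M + M' + N = X + Z then ((qHahnHat q n ((X : ℤ) - M) a b N : ℝ) : ℂ) * c else 0 := by
  simp only [mul_ite, mul_zero]
  split_ifs with hN
  · rcases le_or_gt M X with hX | hX
    · rcases le_or_gt M' Z with hZ | hZ
      · have hmem : (X - M, Z - M') ∈ antidiagonal N := mem_antidiagonal.2 (by dsimp only; omega)
        rw [Finset.sum_eq_single_of_mem _ hmem, if_pos (by omega), Nat.cast_sub hX]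
        exact fun x _ hx => if_neg fun h =>
          hx (Prod.ext (by dsimp only; omega) (by dsimp only; omega))
      · rw [qHahnHat, if_neg (by omega), Complex.ofReal_zero, zero_mul]
        exact Finset.sum_eq_zero fun x _ => if_neg (by omega)
    · rw [qHahnHat, if_neg (by omega), Complex.ofReal_zero, zero_mul]
      exact Finset.sum_eq_zero fun x _ => if_neg (by omega)
  · refine Finset.sum_eq_zero fun x hx => if_neg ?_
    rw [mem_antidiagonal] at hx
    omega

variable {d : ℕ} {q : ℝ} {α : Fin d → ℝ}

/-- The coefficient contributed by the coupling of the factor `i + 3` to the factors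
`2, …, i + 2`. -/
def stageFactor (q : ℝ) (α : Fin d → ℝ) (s y : Fin d → ℕ) (i : ℕ) : ℝ :=
  qHahnHat q (entry s (i + 2)) ((psum y 2 (i + 2) : ℕ) - (psum s 2 (i + 1) : ℕ))
    (stageType α i s) (entry α (i + 3)) ((psum y 2 (i + 3) : ℕ) - (psum s 2 (i + 1) : ℕ))

theorem prod_stageFactor_update₂ (s y : Fin d → ℕ) {p p' : Fin d} (x z : ℕ) {k : ℕ}
    (hp : (p : ℕ) = 0 ∨ k + 1 ≤ p) (hp' : k + 1 ≤ p') :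
    ∏ i ∈ Finset.range k, stageFactor q α (update₂ s p p' x z) y i =
      ∏ i ∈ Finset.range k, stageFactor q α s y i := by
  refine Finset.prod_congr rfl fun i hi => ?_
  rw [Finset.mem_range] at hi
  rw [stageFactor, (indepAt_stageType α (by omega)).apply_update₂ (indepAt_stageType α (by omega)),
    entry_update₂_of_ne _ _ _ _ _ (by omega) (by omega),
    psum_update₂ _ _ _ _ _ (by omega) (by omega), stageFactor]

/-- The multi-indices `s` and `y` agree on the factors outside `{2, …, k + 2}`, which are not
touched by `stage q α k`. -/
def UncoupledAgree (k : ℕ) (s y : Fin d → ℕ) : Prop :=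
  entry s 1 = entry y 1 ∧ ∀ j, k + 3 ≤ j → entry s j = entry y j

theorem uncoupledAgree_update₂ {k : ℕ} (hk : k + 2 < d) (s y : Fin d → ℕ) (x z : ℕ) :
    UncoupledAgree k (update₂ s ⟨k + 1, by omega⟩ ⟨k + 2, hk⟩ x z) y ↔
      UncoupledAgree (k + 1) s y ∧ z = entry y (k + 3) := by
  have hne : ∀ j, j = 1 ∨ k + 4 ≤ j →
      entry (update₂ s ⟨k + 1, by omega⟩ ⟨k + 2, hk⟩ x z) j = entry s j := fun j hj =>
    entry_update₂_of_ne _ _ _ _ _ (by dsimp only; omega) (by dsimp only; omega)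
  have hz : entry (update₂ s ⟨k + 1, by omega⟩ ⟨k + 2, hk⟩ x z) (k + 3) = z :=
    entry_update₂_right ..
  rw [UncoupledAgree, UncoupledAgree, hne 1 (Or.inl rfl), and_assoc]
  refine and_congr_right fun _ => ⟨fun h => ⟨fun j hj => ?_, ?_⟩, fun ⟨h, hzy⟩ j hj => ?_⟩
  · rw [← hne j (Or.inr hj), h j (by omega)]
  · rw [← h (k + 3) le_rfl, hz]
  · rcases hj.eq_or_lt with rfl | hj
    · rw [hz, hzy]
    · rw [hne j (Or.inr hj), h j hj]

theorem psum_stage_update₂ {k : ℕ} (hk : k + 2 < d) (s : Fin d → ℕ) (x z : ℕ) :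
    psum (update₂ s ⟨k + 1, by omega⟩ ⟨k + 2, hk⟩ x z) 2 (k + 2) = psum s 2 (k + 1) + x := by
  have hx := entry_update₂_left (p := ⟨k + 1, by omega⟩) (p' := ⟨k + 2, hk⟩)
    (by simp [Fin.ext_iff]) s x z
  rw [psum_succ _ (by omega), psum_update₂ _ _ _ _ _ (Or.inr (by simp)) (Or.inr (by simp)), hx]

theorem uncoupledAgree_zero_and_iff {s y : Fin d → ℕ} :
    UncoupledAgree 0 s y ∧ psum s 2 2 = psum y 2 2 ↔ s = y := by
  refine ⟨fun ⟨⟨h₁, h₃⟩, h₂⟩ => ext_entry fun k hk _ => ?_, ?_⟩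
  · rw [psum_self, psum_self] at h₂
    rcases (by omega : k = 1 ∨ k = 2 ∨ 3 ≤ k) with rfl | rfl | hk
    · exact h₁
    · exact h₂
    · exact h₃ k hk
  · rintro rfl
    exact ⟨⟨rfl, fun _ _ => rfl⟩, rfl⟩

open scoped Classical in
theorem repr_stage {k : ℕ} (hk : k + 1 < d) (s y : Fin d → ℕ) :
    (e d).repr (stage q α k s) y =
      if UncoupledAgree k s y ∧ psum s 2 (k + 2) = psum y 2 (k + 2) then
        ((∏ i ∈ Finset.range k, stageFactor q α s y i : ℝ) : ℂ) else 0 := by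
  induction k generalizing s with
  | zero =>
    rw [stage, Module.Basis.repr_self, Finsupp.single_apply, Finset.prod_range_zero,
      Complex.ofReal_one]
    exact if_congr uncoupledAgree_zero_and_iff.symm rfl rfl
  | succ k ih =>
    have hs : psum s 2 (k + 1 + 2) = psum s 2 (k + 1) + (entry s (k + 2) + entry s (k + 3)) := by
      rw [psum_succ s (by omega), psum_succ s (by omega), add_assoc]
    have hy : psum y 2 (k + 1 + 2) = psum y 2 (k + 2) + entry y (k + 3) :=
      psum_succ y (by omega)
    have hcond : ∀ x z, (UncoupledAgree k (update₂ s ⟨k + 1, by omega⟩ ⟨k + 2, hk⟩ x z) y ∧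
        psum (update₂ s ⟨k + 1, by omega⟩ ⟨k + 2, hk⟩ x z) 2 (k + 2) = psum y 2 (k + 2)) ↔
        UncoupledAgree (k + 1) s y ∧ psum s 2 (k + 1) + x = psum y 2 (k + 2) ∧
          0 + z = entry y (k + 3) := fun x z => by
      rw [uncoupledAgree_update₂ hk, psum_stage_update₂ hk, zero_add, and_assoc,
        and_comm (a := z = _)]
    rw [stage_succ hk, repr_couple]
    simp only [ih (by omega), hcond,
      prod_stageFactor_update₂ s y (p := ⟨k + 1, by omega⟩) (p' := ⟨k + 2, hk⟩) _ _
        (Or.inr le_rfl) (Nat.le_succ _)]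
    by_cases hU : UncoupledAgree (k + 1) s y
    · simp only [hU, true_and]
      rw [sum_qHahnHat_mul_ite, ← entry_val_succ s, ← entry_val_succ s, ← entry_val_succ α,
        add_zero]
      refine ite_congr (by rw [hs, hy]) (fun h => ?_) fun _ => rfl
      rw [Finset.prod_range_succ, mul_comm, Complex.ofReal_mul, stageFactor, ← h, hs]
      push_cast
      rw [add_sub_cancel_left]
    · simp only [hU, false_and, if_false, mul_zero, Finset.sum_const_zero]

end coefficients

/-! ### The coupled basis -/

section coupled

variable {D : ℕ} {q : ℝ} {α : Fin (D + 2) → ℝ}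

/-- The labels of the coupled basis in the positions in which the successive couplings put them,
`(m_{d-1}, m_1, …, m_{d-2}, m_d)`. -/
def rotate (m : Fin (D + 2) → ℕ) (l : Fin (D + 2)) : ℕ :=
  if l = 0 then entry m (D + 1) else if l = Fin.last (D + 1) then entry m (D + 2) else entry m l

theorem rotate_zero (m : Fin (D + 2) → ℕ) : rotate m 0 = entry m (D + 1) := if_pos rfl

theorem rotate_last (m : Fin (D + 2) → ℕ) : rotate m (Fin.last (D + 1)) = entry m (D + 2) := by
  rw [rotate, if_neg (by simp [Fin.ext_iff]), if_pos rfl]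

theorem entry_rotate (m : Fin (D + 2) → ℕ) {j : ℕ} (hj : 1 ≤ j) (hjD : j ≤ D) :
    entry (rotate m) (j + 1) = entry m j := by
  have h := entry_val_succ (rotate m) ⟨j, by omega⟩
  rw [rotate, if_neg, if_neg] at h
  · exact h
  all_goals simp only [Fin.ext_iff, Fin.val_zero, Fin.val_last]; omega

theorem psum_rotate (m : Fin (D + 2) → ℕ) {j : ℕ} (hj : j ≤ D) :
    psum (rotate m) 2 (j + 1) = psum m 1 j := by
  induction j with
  | zero => rw [psum_of_lt _ (by omega), psum_of_lt _ (by omega)]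
  | succ j ih =>
    rw [psum_succ _ (by omega), ih (by omega), psum_succ _ (by omega),
      entry_rotate m (by omega) hj]

theorem rotate_injective : Function.Injective (rotate (D := D)) := by
  intro m m' h
  refine ext_entry fun k hk hkd => ?_
  rcases (by omega : k = D + 1 ∨ k = D + 2 ∨ k ≤ D) with rfl | rfl | hkD
  · rw [← rotate_zero, h, rotate_zero]
  · rw [← rotate_last, h, rotate_last]
  · rw [← entry_rotate m hk hkD, h, entry_rotate m' hk hkD]

theorem stageType_rotate (m : Fin (D + 2) → ℕ) {j : ℕ} (hj : j ≤ D) :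
    stageType α j (rotate m) = 2 * ((psum m 1 j : ℕ) : ℝ) + psum α 2 (j + 2) + j := by
  rw [stageType, psum_rotate m hj]

theorem coupledType_rotate (m : Fin (D + 2) → ℕ) :
    coupledType 0 (fun _ => α 0) (stageType α D) (rotate m) =
      2 * ((psum m 1 (D + 1) : ℕ) : ℝ) + psum α 1 (D + 2) + (D + 2 : ℕ) - 1 := by
  rw [coupledType, stageType_rotate m le_rfl, rotate_zero, psum_succ m (by omega),
    psum_eq_entry_add α (by omega : 1 ≤ D + 2), ← entry_val_succ α 0, Fin.val_zero, zero_add]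
  push_cast
  ring

/-- The coupled basis `(u_m)`: the factor `1` is coupled to the coupled factors `2, …, d`. -/
def coupled (q : ℝ) (α : Fin (D + 2) → ℝ) (m : Fin (D + 2) → ℕ) : W (D + 2) :=
  couple q 0 (Fin.last (D + 1)) (fun _ => α 0) (stageType α D) (stage q α D) (rotate m)

theorem Admissible.couplable_full (hα : Admissible α) :
    Couplable 0 (Fin.last (D + 1)) (fun _ => α 0) (stageType α D) where
  ne := by simp [Fin.ext_iff]
  left := indepAt_const _ _
  left' := indepAt_const _ _
  right := indepAt_stageType α (Or.inl rfl)
  right' := indepAt_stageType α (Or.inr le_rfl)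
  neg_one_lt_left _ := hα.neg_one_lt 0
  neg_one_lt_right := neg_one_lt_stageType hα.neg_one_lt le_rfl
  add_ne_zero s := by
    have hα0 : entry α 1 = α 0 := entry_val_succ α 0
    have hne := hα.full_ne_zero
    have hlt := neg_lt_psum hα.neg_one_lt (i := 1) (j := D + 2) le_rfl (by omega) le_rfl
    rw [psum_eq_entry_add α (by omega : 1 ≤ D + 2), hα0] at hne hlt
    push_cast at hne hlt
    convert two_mul_natCast_add_ne_zero (by linarith) hne (psum s 2 (D + 1)) using 1
    rw [stageType]
    ring

theorem ladder_couple_stage (hq0 : 0 < q) (hq1 : q < 1) (hα : Admissible α) :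
    Ladder q (generators q α 1 (D + 2)) (Fin.last (D + 1))
      (coupledType 0 (fun _ => α 0) (stageType α D))
      (couple q 0 (Fin.last (D + 1)) (fun _ => α 0) (stageType α D) (stage q α D)) := by
  rw [generators_eq_coproduct q α (j := 1) (by omega) (by omega)]
  exact hα.couplable_full.ladder_couple hq0 hq1
    (ladder_stage_of_uncoupled (by omega) (l := 0) (Or.inl rfl))
    (ladder_stage hq0 hq1 hα (by omega))

theorem jointEigen_coupled (hq0 : 0 < q) (hq1 : q < 1) (hα : Admissible α)
    (m : Fin (D + 2) → ℕ) : JointEigen q α m (coupled q α m) where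
  intermediate k hk hkd := by
    obtain ⟨j, rfl⟩ := Nat.exists_eq_add_of_le' (by omega : 2 ≤ k)
    have htype : 2 * ((psum m 1 (j + 2 - 2) : ℕ) : ℝ) + psum α 2 (j + 2) + (j + 2 : ℕ) - 2 =
        stageType α j (rotate m) := by
      rw [stageType_rotate m (by omega), Nat.add_sub_cancel]
      push_cast
      ring
    rw [htype]
    refine map_couple rfl rfl rfl rfl fun x z _ => ?_
    rw [casimir_stage hq0 hq1 hα (by omega) (by omega),
      (indepAt_stageType α (Or.inl rfl)).apply_update₂
        (indepAt_stageType α (Or.inr (by rw [Fin.val_last]; omega)))]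
  full := by
    rw [← casimir_generators]
    exact ((ladder_couple_stage hq0 hq1 hα).casimir hq0 hq1
      hα.couplable_full.indepAt_coupledType hα.couplable_full.neg_one_lt_coupledType
      (rotate m)).trans (by rw [coupledType_rotate, coupled, Nat.add_succ_sub_one])
  weight := by
    refine ((ladder_couple_stage hq0 hq1 hα).weight 1 (rotate m)).trans ?_
    rw [coupledType_rotate, rotate_last, coupled, psum_succ m (by omega : 1 ≤ D + 1 + 1)]
    congr 3
    push_cast
    ring

theorem isOrthonormal_coupled (hq0 : 0 < q) (hq1 : q < 1) (hα : Admissible α) :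
    IsOrthonormal (coupled q α) := fun m m' => by
  rw [coupled, coupled, hα.couplable_full.isOrthonormal_couple hq0 hq1
    (isOrthonormal_stage hq0 hq1 hα (by omega))]
  simp only [rotate_injective.eq_iff]

theorem Xi_eq_prod_stageFactor (m y : Fin (D + 2) → ℕ) :
    Xi q α m y = (if psum m 1 (D + 2) = psum y 1 (D + 2) then 1 else 0) *
      (∏ i ∈ Finset.range D, stageFactor q α (rotate m) y i) *
      qHahnHat q (entry m (D + 1)) ((entry y 1 : ℕ) : ℤ) (α 0) (stageType α D (rotate m))
        ((psum y 1 (D + 2) : ℕ) - (psum m 1 D : ℕ)) := by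
  have hα0 : entry α 1 = α 0 := entry_val_succ α 0
  simp only [Xi]
  rw [Nat.add_sub_cancel, ← Finset.Ico_add_one_right_eq_Icc, Finset.prod_Ico_eq_prod_range, hα0,
    Nat.add_sub_cancel, stageType_rotate m le_rfl]
  congr 1
  · refine congrArg _ (Finset.prod_congr rfl fun i hi => ?_)
    rw [Finset.mem_range] at hi
    rw [stageFactor, entry_rotate m (by omega) (by omega), psum_rotate m hi.le,
      stageType_rotate m hi.le, Nat.add_sub_cancel_left, add_comm 1 i]
    congr 1
    push_cast
    ring
  · congr 1
    push_cast
    ring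

theorem uncoupledAgree_last_iff {s y : Fin (D + 2) → ℕ} :
    UncoupledAgree D s y ↔ entry s 1 = entry y 1 :=
  and_iff_left fun j hj => by rw [entry_of_lt s (by omega), entry_of_lt y (by omega)]

theorem repr_coupled (m y : Fin (D + 2) → ℕ) :
    (e (D + 2)).repr (coupled q α m) y = (Xi q α m y : ℂ) := by
  have hm : psum m 1 (D + 2) = psum m 1 D + (entry m (D + 1) + entry m (D + 2)) := by
    rw [psum_succ m (by omega), psum_succ m (by omega), add_assoc]
  have hy : psum y 1 (D + 2) = entry y 1 + psum y 2 (D + 2) := psum_eq_entry_add y (by omega)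
  have hterm : ∀ x z, (e (D + 2)).repr
      (stage q α D (update₂ (rotate m) 0 (Fin.last (D + 1)) x z)) y =
      if 0 + x = entry y 1 ∧ psum m 1 D + z = psum y 2 (D + 2) then
        ((∏ i ∈ Finset.range D, stageFactor q α (rotate m) y i : ℝ) : ℂ) else 0 := by
    intro x z
    have hx : entry (update₂ (rotate m) 0 (Fin.last (D + 1)) x z) 1 = x :=
      entry_update₂_left (by simp [Fin.ext_iff]) _ x z
    have hz : entry (update₂ (rotate m) 0 (Fin.last (D + 1)) x z) (D + 2) = z :=
      entry_update₂_right _ _ _ x z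
    rw [repr_stage (by omega), prod_stageFactor_update₂ _ _ _ _ (Or.inl rfl) le_rfl, zero_add,
      uncoupledAgree_last_iff, hx, psum_succ _ (by omega), hz,
      psum_update₂ _ _ _ _ _ (Or.inl (by simp)) (Or.inr (by simp)), psum_rotate m le_rfl]
    congr
  rw [coupled, repr_couple]
  simp only [hterm]
  rw [sum_qHahnHat_mul_ite, rotate_zero, rotate_last, Xi_eq_prod_stageFactor, zero_add, ← hm, ← hy]
  split_ifs with h
  · rw [← h, hm]
    push_cast
    rw [one_mul, mul_comm, sub_zero, add_sub_cancel_left]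
  · rw [zero_mul, zero_mul, Complex.ofReal_zero]

end coupled

/-! ### Orthogonality relations and expansions -/

section expansions

/-- The multi-indices of total degree `N`; `Ξ` vanishes unless both of its arguments have the same
total degree. -/
def level (d N : ℕ) : Finset (Fin d → ℕ) := Finset.piAntidiag Finset.univ N

theorem mem_level {d N : ℕ} {y : Fin d → ℕ} : y ∈ level d N ↔ psum y 1 d = N := by
  simp [level, psum_one_eq_sum]

theorem psum_eq_of_Xi_ne_zero {d : ℕ} {q : ℝ} {α : Fin d → ℝ} {m y : Fin d → ℕ}
    (h : Xi q α m y ≠ 0) : psum m 1 d = psum y 1 d := by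
  by_contra hne
  simp [Xi, hne] at h

theorem finite_setOf_Xi_ne_zero_right {d : ℕ} (q : ℝ) (α : Fin d → ℝ) (m : Fin d → ℕ) :
    {y | Xi q α m y ≠ 0}.Finite :=
  (level d (psum m 1 d)).finite_toSet.subset fun _ h => mem_level.2 (psum_eq_of_Xi_ne_zero h).symm

theorem finite_setOf_Xi_ne_zero_left {d : ℕ} (q : ℝ) (α : Fin d → ℝ) (y : Fin d → ℕ) :
    {m | Xi q α m y ≠ 0}.Finite :=
  (level d (psum y 1 d)).finite_toSet.subset fun _ h => mem_level.2 (psum_eq_of_Xi_ne_zero h)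

theorem finsum_eq_sum_level {M : Type*} [AddCommMonoid M] {d N : ℕ} {f : (Fin d → ℕ) → M}
    (hf : ∀ y, psum y 1 d ≠ N → f y = 0) : ∑ᶠ y, f y = ∑ y ∈ level d N, f y :=
  finsum_eq_sum_of_support_subset f fun y hy => mem_level.2 (of_not_not fun h => hy (hf y h))

variable {D : ℕ} {q : ℝ} {α : Fin (D + 2) → ℝ}

theorem sum_Xi_smul_coupled_repr (y y' : Fin (D + 2) → ℕ) (N : ℕ) :
    (e (D + 2)).repr (∑ m ∈ level (D + 2) N, (Xi q α m y : ℂ) • coupled q α m) y' =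
      ((∑ m ∈ level (D + 2) N, Xi q α m y * Xi q α m y' : ℝ) : ℂ) := by
  simp only [map_sum, map_smul, Finsupp.finsetSum_apply, Finsupp.smul_apply, smul_eq_mul,
    repr_coupled, Complex.ofReal_sum, Complex.ofReal_mul]

theorem coupled_eq_sum {m : Fin (D + 2) → ℕ} {N : ℕ} (hm : psum m 1 (D + 2) = N) :
    coupled q α m = ∑ y ∈ level (D + 2) N, (Xi q α m y : ℂ) • e (D + 2) y := by
  refine (e (D + 2)).ext_elem fun y => ?_
  simp only [repr_coupled, map_sum, map_smul, Module.Basis.repr_self, Finsupp.finsetSum_apply,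
    Finsupp.smul_apply, Finsupp.single_apply, smul_eq_mul, mul_ite, mul_one, mul_zero,
    Finset.sum_ite_eq']
  split_ifs with hy
  · rfl
  · rw [mem_level, ← hm] at hy
    rw [of_not_not fun h => hy (psum_eq_of_Xi_ne_zero h).symm, Complex.ofReal_zero]

theorem sum_Xi_mul_row (hq0 : 0 < q) (hq1 : q < 1) (hα : Admissible α)
    {m : Fin (D + 2) → ℕ} (m' : Fin (D + 2) → ℕ) {N : ℕ} (hm : psum m 1 (D + 2) = N) :
    ∑ y ∈ level (D + 2) N, Xi q α m y * Xi q α m' y = if m = m' then 1 else 0 := by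
  have h := isOrthonormal_coupled hq0 hq1 hα m m'
  rw [coupled_eq_sum hm, ip_sum_left] at h
  simp only [ip_e_left, repr_coupled, Complex.conj_ofReal] at h
  split_ifs at h ⊢ <;> exact_mod_cast h

theorem sum_Xi_mul_col (hq0 : 0 < q) (hq1 : q < 1) (hα : Admissible α)
    {y : Fin (D + 2) → ℕ} (y' : Fin (D + 2) → ℕ) {N : ℕ} (hy : psum y 1 (D + 2) = N) :
    ∑ m ∈ level (D + 2) N, Xi q α m y * Xi q α m y' = if y = y' then 1 else 0 := by
  by_cases hy' : psum y' 1 (D + 2) = N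
  · let X : Matrix (level (D + 2) N) (level (D + 2) N) ℝ := .of fun m y => Xi q α m y
    have hX : X * X.transpose = 1 := by
      ext m m'
      simp only [X, Matrix.mul_apply, Matrix.one_apply, Matrix.transpose_apply, Matrix.of_apply,
        Finset.sum_coe_sort (level (D + 2) N) fun y => Xi q α m y * Xi q α m' y,
        sum_Xi_mul_row hq0 hq1 hα m' (mem_level.1 m.2), Subtype.ext_iff]
    have hX' : X.transpose * X = 1 := mul_eq_one_comm.1 hX
    have hentry := congr_fun₂ hX' ⟨y, mem_level.2 hy⟩ ⟨y', mem_level.2 hy'⟩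
    simpa only [X, Matrix.mul_apply, Matrix.one_apply, Matrix.transpose_apply, Matrix.of_apply,
      Finset.sum_coe_sort (level (D + 2) N) fun m => Xi q α m y * Xi q α m y',
      Subtype.mk.injEq] using hentry
  · rw [if_neg (by rintro rfl; exact hy' hy)]
    refine Finset.sum_eq_zero fun m hm => mul_eq_zero_of_right _ (of_not_not fun h => hy' ?_)
    rw [← psum_eq_of_Xi_ne_zero h, mem_level.1 hm]

theorem finsum_Xi_mul_row (hq0 : 0 < q) (hq1 : q < 1) (hα : Admissible α)
    (m m' : Fin (D + 2) → ℕ) :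
    ∑ᶠ y, Xi q α m y * Xi q α m' y = if m = m' then 1 else 0 := by
  rw [← sum_Xi_mul_row hq0 hq1 hα m' rfl]
  exact finsum_eq_sum_level fun y hy =>
    mul_eq_zero_of_left (of_not_not fun h => hy (psum_eq_of_Xi_ne_zero h).symm) _

theorem finsum_Xi_mul_col (hq0 : 0 < q) (hq1 : q < 1) (hα : Admissible α)
    (y y' : Fin (D + 2) → ℕ) :
    ∑ᶠ m, Xi q α m y * Xi q α m y' = if y = y' then 1 else 0 := by
  rw [← sum_Xi_mul_col hq0 hq1 hα y' rfl]
  exact finsum_eq_sum_level fun m hm =>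
    mul_eq_zero_of_left (of_not_not fun h => hm (psum_eq_of_Xi_ne_zero h)) _

theorem coupled_eq_finsum (m : Fin (D + 2) → ℕ) :
    coupled q α m = ∑ᶠ y, (Xi q α m y : ℂ) • e (D + 2) y := by
  rw [coupled_eq_sum rfl]
  exact (finsum_eq_sum_level fun y hy => by
    rw [of_not_not fun h => hy (psum_eq_of_Xi_ne_zero h).symm, Complex.ofReal_zero, zero_smul]).symm

theorem e_eq_sum (hq0 : 0 < q) (hq1 : q < 1) (hα : Admissible α) (y : Fin (D + 2) → ℕ) :
    e (D + 2) y =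
      ∑ m ∈ level (D + 2) (psum y 1 (D + 2)), (Xi q α m y : ℂ) • coupled q α m := by
  refine (e (D + 2)).ext_elem fun y' => ?_
  rw [sum_Xi_smul_coupled_repr, sum_Xi_mul_col hq0 hq1 hα y' rfl, Module.Basis.repr_self,
    Finsupp.single_apply, apply_ite Complex.ofReal, Complex.ofReal_one, Complex.ofReal_zero]

theorem e_eq_finsum (hq0 : 0 < q) (hq1 : q < 1) (hα : Admissible α) (y : Fin (D + 2) → ℕ) :
    e (D + 2) y = ∑ᶠ m, (Xi q α m y : ℂ) • coupled q α m := by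
  rw [e_eq_sum hq0 hq1 hα y]
  exact (finsum_eq_sum_level fun m hm => by
    rw [of_not_not fun h => hm (psum_eq_of_Xi_ne_zero h), Complex.ofReal_zero, zero_smul]).symm

theorem span_range_coupled (hq0 : 0 < q) (hq1 : q < 1) (hα : Admissible α) :
    Submodule.span ℂ (Set.range (coupled q α)) = ⊤ := by
  rw [eq_top_iff, ← (e (D + 2)).span_eq, Submodule.span_le]
  rintro _ ⟨y, rfl⟩
  rw [SetLike.mem_coe, e_eq_sum hq0 hq1 hα y]
  exact Submodule.sum_mem _ fun m _ =>
    Submodule.smul_mem _ _ (Submodule.subset_span (Set.mem_range_self m))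

theorem isCoupledBasis_coupled (hq0 : 0 < q) (hq1 : q < 1) (hα : Admissible α) :
    IsCoupledBasis q α (coupled q α) where
  orthonormal := isOrthonormal_coupled hq0 hq1 hα
  span := span_range_coupled hq0 hq1 hα
  eigen := jointEigen_coupled hq0 hq1 hα

end expansions

/-! ### Uniqueness -/

section uniqueness

theorem abs_eq_abs_of_gamma_eq {q a b : ℝ} (hq0 : 0 < q) (hq1 : q < 1)
    (h : gamma q a = gamma q b) : |a| = |b| := by
  have hD : (q ^ (1 / 2 : ℝ) - q ^ (-1 / 2 : ℝ)) ^ 2 ≠ 0 :=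
    pow_ne_zero 2 (sub_neg.2 (Real.rpow_lt_rpow_of_exponent_gt hq0 hq1 (by norm_num))).ne
  have hu := (Real.rpow_pos_of_pos hq0 (a / 2)).ne'
  have hv := (Real.rpow_pos_of_pos hq0 (b / 2)).ne'
  rw [gamma, gamma, div_left_inj' hD, neg_div, neg_div, Real.rpow_neg hq0.le,
    Real.rpow_neg hq0.le] at h
  have hfactor : (q ^ (a / 2) - q ^ (b / 2)) * (1 - q ^ (a / 2) * q ^ (b / 2)) = 0 := by
    field_simp at h
    linear_combination -h
  rw [abs_eq_abs]
  rcases mul_eq_zero.1 hfactor with h | h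
  · left
    linarith [(Real.rpow_right_inj hq0 hq1.ne).1 (sub_eq_zero.1 h)]
  · right
    rw [sub_eq_zero, ← Real.rpow_add hq0, ← Real.rpow_zero q, Real.rpow_right_inj hq0 hq1.ne] at h
    linarith

theorem gamma_two_mul_add_injective {q s : ℝ} (hq0 : 0 < q) (hq1 : q < 1) (hs : -1 < s) :
    Function.Injective fun n : ℕ => gamma q (2 * n + s) := by
  intro n n' h
  rcases abs_eq_abs.1 (abs_eq_abs_of_gamma_eq hq0 hq1 h) with h | h
  · exact_mod_cast (by linarith : (n : ℝ) = n')
  · have hlt : (n : ℝ) + n' < 1 := by linarith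
    have : n + n' < 1 := mod_cast hlt
    omega

variable {d : ℕ} {q : ℝ} {α : Fin d → ℝ}

theorem ext_psum {m m' : Fin d → ℕ} (h : ∀ j, 1 ≤ j → j ≤ d → psum m 1 j = psum m' 1 j) :
    m = m' := by
  refine ext_entry fun k hk hkd => ?_
  rcases hk.eq_or_lt with rfl | hk
  · simpa only [psum_self] using h 1 le_rfl hkd
  · obtain ⟨j, rfl⟩ := Nat.exists_eq_add_of_le' hk.le
    have hsum := h (j + 1) (by omega) hkd
    rw [psum_succ m (by omega), psum_succ m' (by omega), h j (by omega) (by omega)] at hsum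
    omega

theorem eq_of_jointEigenvalues_eq (hq0 : 0 < q) (hq1 : q < 1) (hd : 2 ≤ d)
    (hα : ∀ k, -1 < α k) {m m' : Fin d → ℕ}
    (hintermediate : ∀ k : ℕ, 3 ≤ k → k ≤ d →
      gamma q (2 * ((psum m 1 (k - 2) : ℕ) : ℝ) + psum α 2 k + k - 2) =
        gamma q (2 * ((psum m' 1 (k - 2) : ℕ) : ℝ) + psum α 2 k + k - 2))
    (hfull : gamma q (2 * ((psum m 1 (d - 1) : ℕ) : ℝ) + psum α 1 d + d - 1) =
      gamma q (2 * ((psum m' 1 (d - 1) : ℕ) : ℝ) + psum α 1 d + d - 1))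
    (hweight : q ^ (((psum m 1 d : ℕ) : ℝ) + (psum α 1 d + d) / 2) =
      q ^ (((psum m' 1 d : ℕ) : ℝ) + (psum α 1 d + d) / 2)) : m = m' := by
  refine ext_psum fun j hj hjd => ?_
  rcases (by omega : j + 2 ≤ d ∨ j = d - 1 ∨ j = d) with hj2 | rfl | rfl
  · have hlt := neg_lt_psum hα (i := 2) (j := j + 2) (by omega) (by omega) hj2
    have h := hintermediate (j + 2) (by omega) hj2
    simp only [Nat.add_sub_cancel, add_assoc, add_sub_assoc] at h
    refine gamma_two_mul_add_injective hq0 hq1 ?_ h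
    push_cast at hlt ⊢
    linarith
  · have hlt := neg_lt_psum hα (i := 1) (j := d) le_rfl (by omega) le_rfl
    simp only [add_assoc, add_sub_assoc] at hfull
    refine gamma_two_mul_add_injective hq0 hq1 ?_ hfull
    push_cast at hlt
    have : (2 : ℝ) ≤ d := mod_cast hd
    linarith
  · exact_mod_cast add_right_cancel ((Real.rpow_right_inj hq0 hq1.ne).1 hweight)

theorem IsOrthonormal.eigenvalue_eq {u : (Fin d → ℕ) → W d} (hu : IsOrthonormal u)
    {T : Module.End ℂ (W d)} {c : (Fin d → ℕ) → ℝ} (hT : ∀ m, T (u m) = (c m : ℂ) • u m)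
    (f : (Fin d → ℕ) →₀ ℂ) {l : ℝ}
    (hf : T (f.sum fun m x => x • u m) = (l : ℂ) • f.sum fun m x => x • u m)
    {m : Fin d → ℕ} (hm : f m ≠ 0) : c m = l := by
  have hu' : ∀ s s', ip (u s) (u s') = if s = s' then 1 else 0 := hu
  have h := congrArg (ip (u m)) hf
  simp only [Finsupp.sum, map_sum, map_smul, hT, Finset.smul_sum, smul_smul, ip_sum_right, hu',
    mul_ite, mul_one, mul_zero, Finset.sum_ite_eq, if_pos (Finsupp.mem_support_iff.2 hm)] at h
  rw [mul_comm] at h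
  exact_mod_cast mul_right_cancel₀ hm h

theorem IsCoupledBasis.unique (hq0 : 0 < q) (hq1 : q < 1) (hd : 2 ≤ d) (hα : ∀ k, -1 < α k)
    {u u' : (Fin d → ℕ) → W d} (hu : IsCoupledBasis q α u) (hu' : IsCoupledBasis q α u')
    (m : Fin d → ℕ) : ∃ ε : ℂ, ‖ε‖ = 1 ∧ u' m = ε • u m := by
  obtain ⟨f, hf⟩ := Finsupp.mem_span_range_iff_exists_finsupp.1
    (hu.span ▸ Submodule.mem_top : u' m ∈ Submodule.span ℂ (Set.range u))
  have horth : IsOrthonormal u := hu.orthonormal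
  have heigen := hf ▸ hu'.eigen m
  have hzero : ∀ m', m' ≠ m → f m' = 0 := fun m' hne => of_not_not fun h0 =>
    hne <| eq_of_jointEigenvalues_eq hq0 hq1 hd hα
      (fun k hk hkd => horth.eigenvalue_eq (fun m => (hu.eigen m).intermediate k hk hkd) f
        (heigen.intermediate k hk hkd) h0)
      (horth.eigenvalue_eq (fun m => (hu.eigen m).full) f heigen.full h0)
      (horth.eigenvalue_eq (fun m => (hu.eigen m).weight) f heigen.weight h0)
  have hmul : u' m = f m • u m := by
    rw [← hf]
    refine Finset.sum_eq_single m (fun m' _ hne => ?_) fun hm => ?_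
    · simp only [hzero m' hne, zero_smul]
    · simp only [Finsupp.notMem_support_iff.1 hm, zero_smul]
  refine ⟨f m, ?_, hmul⟩
  have hnorm := hu'.orthonormal m m
  rw [hmul, ip_smul_left, ip_smul_right, hu.orthonormal, if_pos rfl, mul_one,
    Complex.conj_mul'] at hnorm
  exact (pow_eq_one_iff_of_nonneg (norm_nonneg _) two_ne_zero).1 (mod_cast hnorm)

theorem Admissible.of_pos (hd : 2 ≤ d) (hα : ∀ k, 0 < α k) : Admissible α := by
  have hnonneg : ∀ i j, 0 ≤ psum α i j := fun i j => Finset.sum_nonneg fun k _ => by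
    unfold entry
    split_ifs
    · exact (hα _).le
    · exact le_rfl
  refine ⟨fun k => by linarith [hα k], fun k hk _ => ?_, ?_⟩
  · have : (3 : ℝ) ≤ k := mod_cast hk
    exact (by linarith [hnonneg 2 k] : 0 < psum α 2 k + k - 2).ne'
  · have : (2 : ℝ) ≤ d := mod_cast hd
    exact (by linarith [hnonneg 1 d] : 0 < psum α 1 d + d - 1).ne'

end uniqueness

end SUq

end

theorem proposition2_general (q : ℝ) (hq0 : 0 < q) (hq1 : q < 1) (d : ℕ) (hd : 2 ≤ d)
    (α : Fin d → ℝ) (hα : SUq.Admissible α) :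
    (∀ m : Fin d → ℕ, {y : Fin d → ℕ | SUq.Xi q α m y ≠ 0}.Finite) ∧
    (∀ y : Fin d → ℕ, {m : Fin d → ℕ | SUq.Xi q α m y ≠ 0}.Finite) ∧
    (∀ m m' : Fin d → ℕ,
      ∑ᶠ y : Fin d → ℕ, SUq.Xi q α m y * SUq.Xi q α m' y = if m = m' then 1 else 0) ∧
    (∀ y y' : Fin d → ℕ,
      ∑ᶠ m : Fin d → ℕ, SUq.Xi q α m y * SUq.Xi q α m y' = if y = y' then 1 else 0) ∧
    ∃ u : (Fin d → ℕ) → SUq.W d,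
      SUq.IsCoupledBasis q α u ∧
      (∀ m : Fin d → ℕ, u m = ∑ᶠ y : Fin d → ℕ, (SUq.Xi q α m y : ℂ) • SUq.e d y) ∧
      (∀ y : Fin d → ℕ, SUq.e d y = ∑ᶠ m : Fin d → ℕ, (SUq.Xi q α m y : ℂ) • u m) ∧
      (∀ u' : (Fin d → ℕ) → SUq.W d, SUq.IsCoupledBasis q α u' →
        ∀ m : Fin d → ℕ, ∃ ε : ℂ, ‖ε‖ = 1 ∧ u' m = ε • u m) := by
  obtain ⟨D, rfl⟩ := Nat.exists_eq_add_of_le' hd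
  have hu : SUq.IsCoupledBasis q α (SUq.coupled q α) := SUq.isCoupledBasis_coupled hq0 hq1 hα
  exact ⟨SUq.finite_setOf_Xi_ne_zero_right q α, SUq.finite_setOf_Xi_ne_zero_left q α,
    SUq.finsum_Xi_mul_row hq0 hq1 hα, SUq.finsum_Xi_mul_col hq0 hq1 hα,
    SUq.coupled q α, hu, SUq.coupled_eq_finsum, SUq.e_eq_finsum hq0 hq1 hα,
    fun _ hu' => hu.unique hq0 hq1 hd hα.neg_one_lt hu'⟩

theorem proposition2 (q : ℝ) (hq0 : 0 < q) (hq1 : q < 1) (d : ℕ) (hd : 2 ≤ d)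
    (α : Fin d → ℝ) (hα : ∀ k, 0 < α k) :
    -- all the sums below are finite
    (∀ m : Fin d → ℕ, {y : Fin d → ℕ | SUq.Xi q α m y ≠ 0}.Finite) ∧
    (∀ y : Fin d → ℕ, {m : Fin d → ℕ | SUq.Xi q α m y ≠ 0}.Finite) ∧
    -- the two orthogonality relations
    (∀ m m' : Fin d → ℕ,
      ∑ᶠ y : Fin d → ℕ, SUq.Xi q α m y * SUq.Xi q α m' y = if m = m' then 1 else 0) ∧
    (∀ y y' : Fin d → ℕ,
      ∑ᶠ m : Fin d → ℕ, SUq.Xi q α m y * SUq.Xi q α m y' = if y = y' then 1 else 0) ∧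
    -- the coupled basis and the two expansion formulas
    ∃ u : (Fin d → ℕ) → SUq.W d,
      SUq.IsCoupledBasis q α u ∧
      (∀ m : Fin d → ℕ, u m = ∑ᶠ y : Fin d → ℕ, (SUq.Xi q α m y : ℂ) • SUq.e d y) ∧
      (∀ y : Fin d → ℕ, SUq.e d y = ∑ᶠ m : Fin d → ℕ, (SUq.Xi q α m y : ℂ) • u m) ∧
      -- the eigenvalue equations determine the basis up to phases
      (∀ u' : (Fin d → ℕ) → SUq.W d, SUq.IsCoupledBasis q α u' →
        ∀ m : Fin d → ℕ, ∃ ε : ℂ, ‖ε‖ = 1 ∧ u' m = ε • u m) :=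
  proposition2_general q hq0 hq1 d hd α (SUq.Admissible.of_pos hd hα)
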